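/- Let $(\Omega,\mathfrak F,P)$ be a probability space. For each $\Delta>0$ let $X_\Delta=(X_\Delta(t),t\in\mathbb R)$ be a stationary centred real-valued Gaussian process on it with correlation function $K_\Delta(t)=\mathsf E X_\Delta(s+t)X_\Delta(s)=\int_{-\infty}^{\infty}e^{i\lambda t}f_\Delta(\lambda)\,d\lambda$, where the spectral densities $f_\Delta\ge 0$ satisfy: $f_\Delta(\lambda)=f_\Delta(-\lambda)$; $\sup_{\Delta>0}\sup_{\lambda}|f_\Delta(\lambda)|<\infty$; $f_\Delta\in L_1(\mathbb R)$; for some constant $c\in(0,\infty)$ and all $a\in(0,\infty)$, $\lim_{\Delta\to\infty}\sup_{-a\le\lambda\le a}\left|f_\Delta(\lambda)-\frac{c}{2\pi}\right|=0$; and $K_\Delta\in L_1(\mathbb R)$. Let $U=(U(t),t\in\mathbb R)$ be a stationary centred real-valued Gaussian process on the same space with spectral density $g\ge 0$, $g(\lambda)=g(-\lambda)$, $g\in L_1(\mathbb R)$, such that for every $\Delta>0$ the processes $X_\Delta$ and $U$ are jointly Gaussian and orthogonal: $\mathsf E X_\Delta(s)U(t)=0$ for all $s,t\in\mathbb R$.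 Let $\alpha\in(0,1]$ and let $H:\mathbb R\to\mathbb R$ belong to $L_2(\mathbb R)\cap Lip_\alpha(\mathbb R)$, where $H\in Lip_\alpha(\mathbb R)$ means that there are $\delta>0$, $M>0$ with $|H(t)-H(s)|\le M|t-s|^\alpha$ whenever $|t-s|<\delta$. Suppose further that $$\forall\delta>0:\ \lim_{\Delta\to\infty}\int_\delta^\infty K_\Delta(t)\,dt=0;\qquad \forall\delta>0:\ \lim_{\Delta\to\infty}\int_\delta^\infty K_\Delta^2(t)\,dt=0;\qquad \exists\delta>0:\ \lim_{\Delta\to\infty}\int_{-\delta}^{\delta}|K_\Delta(t)||t|^\alpha\,dt=0.$$ For $T,\Delta>0$ put $$Y_\Delta(t)=\int_{-\infty}^{\infty}H(s)X_\Delta(t-s)\,ds+U(t),\qquad H_{T,\Delta}(\tau)=\frac1{cT}\int_0^T Y_\Delta(t+\tau)X_\Delta(t)\,dt,\qquad t,\tau\in\mathbb R,$$ where the first integral is the mean-square limit, as $A\to-\infty$ and $B\to\infty$, of the mean-square Riemann integrals over $[A,B]$, and the second is a mean-square Riemann integral. Then all these integrals exist, and for every $\tau\in\mathbb R$ $$\mathsf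 E\,|H_{T,\Delta}(\tau)-H(\tau)|^2\to 0\qquad\text{as } T\to\infty \text{ and } \Delta\to\infty .$$ -/

import Mathlib

open MeasureTheory ProbabilityTheory Filter Topology

noncomputable section

namespace Correlogram

variable {Ω : Type*} [MeasurableSpace Ω]

/-- `I` is the mean-square Riemann integral of the random function `φ` over `[a, b]`, `a ≤ b`:
the tagged Riemann sums of `φ` converge to `I` in `L₂(P)` as the mesh tends to zero. -/
def IsMSRiemannIntegral (P : Measure Ω) (φ : ℝ → Ω → ℝ) (a b : ℝ) (I : Ω → ℝ) : Prop :=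
  a ≤ b ∧ MemLp I 2 P ∧
    ∀ ε : ℝ, 0 < ε → ∃ δ : ℝ, 0 < δ ∧ ∀ (n : ℕ) (x ξ : ℕ → ℝ),
      x 0 = a → x n = b →
      (∀ i < n, x i ≤ ξ i ∧ ξ i ≤ x (i + 1) ∧ x (i + 1) - x i < δ) →
      eLpNorm (fun ω => (∑ i ∈ Finset.range n, (x (i + 1) - x i) * φ (ξ i) ω) - I ω) 2 P
        ≤ ENNReal.ofReal ε

/-- `I` is the improper mean-square integral of the random function `φ` over `ℝ`: the
`L₂(P)`-limit of the mean-square Riemann integrals over `[a, b]` as `a → -∞`, `b → ∞`. -/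
def IsMSIntegral (P : Measure Ω) (φ : ℝ → Ω → ℝ) (I : Ω → ℝ) : Prop :=
  MemLp I 2 P ∧ ∃ J : ℝ → ℝ → Ω → ℝ,
    (∀ a b : ℝ, a ≤ b → IsMSRiemannIntegral P φ a b (J a b)) ∧
    Tendsto (fun p : ℝ × ℝ => eLpNorm (fun ω => J p.1 p.2 ω - I ω) 2 P)
      (atBot ×ˢ atTop) (𝓝 0)

open scoped Classical in
/-- The mean-square Riemann integral over `[a, b]` (determined up to a `P`-null set; `0` if it
does not exist). -/
def msRiemannIntegral (P : Measure Ω) (φ : ℝ → Ω → ℝ) (a b : ℝ) : Ω → ℝ :=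
  if h : ∃ I, IsMSRiemannIntegral P φ a b I then h.choose else 0

open scoped Classical in
/-- The improper mean-square integral over `ℝ` (determined up to a `P`-null set; `0` if it
does not exist). -/
def msIntegral (P : Measure Ω) (φ : ℝ → Ω → ℝ) : Ω → ℝ :=
  if h : ∃ I, IsMSIntegral P φ I then h.choose else 0

/-- The correlation function `K(t) = E Z(s + t) Z(s)` of a stationary process, read at `s = 0`. -/
def corr (P : Measure Ω) (Z : ℝ → Ω → ℝ) (t : ℝ) : ℝ :=
  ∫ ω, Z t ω * Z 0 ω ∂P

/-- A centred stationary real Gaussian process. A centred Gaussian process is stationary exactly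
when `E Z(s + t) Z(s)` does not depend on `s`. -/
structure IsStationaryGaussian (P : Measure Ω) (Z : ℝ → Ω → ℝ) : Prop where
  gaussian : IsGaussianProcess Z P
  centred : ∀ t, ∫ ω, Z t ω ∂P = 0
  stationary : ∀ s t, ∫ ω, Z (s + t) ω * Z s ω ∂P = corr P Z t

/-- `f` is a spectral density of the process with correlation function `K`. -/
structure IsSpectralDensity (f K : ℝ → ℝ) : Prop where
  nonneg : ∀ l, 0 ≤ f l
  integrable : Integrable f
  corr_eq : ∀ t : ℝ,
    (K t : ℂ) = ∫ l : ℝ, Complex.exp (Complex.I * (l : ℂ) * (t : ℂ)) * (f l : ℂ)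

/-- The class `Lip_α(ℝ)`. -/
def LipClass (α : ℝ) (H : ℝ → ℝ) : Prop :=
  ∃ δ : ℝ, 0 < δ ∧ ∃ M : ℝ, 0 < M ∧ ∀ t s : ℝ, |t - s| < δ → |H t - H s| ≤ M * |t - s| ^ α

/-- The response `Y(t) = ∫ H(s) X(t - s) ds + U(t)` of the system with transfer function `H` and
inner noise `U` to the input `X`. -/
def response (P : Measure Ω) (H : ℝ → ℝ) (X U : ℝ → Ω → ℝ) (t : ℝ) : Ω → ℝ :=
  fun ω => msIntegral P (fun s ω' => H s * X (t - s) ω') ω + U t ω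

/-- The correlogram estimator `(1 / (c T)) ∫_0^T Y(t + τ) X(t) dt`. -/
def estimator (P : Measure Ω) (c : ℝ) (H : ℝ → ℝ) (X U : ℝ → Ω → ℝ) (T τ : ℝ) : Ω → ℝ :=
  fun ω => 1 / (c * T) *
    msRiemannIntegral P (fun t ω' => response P H X U (t + τ) ω' * X t ω') 0 T ω

end Correlogram

end

noncomputable section

namespace Correlogram

variable {Ω : Type*} [MeasurableSpace Ω]

/-! ### Mean-square integrals as Bochner integrals in `L₂(P)` -/

section Riemann

/-! Fix Δ. The closed linear span of `X` and `U` in L₂(P) is a Hilbert space of centred Gaussian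
variables, and both processes are continuous curves in it, so mean-square integrals become Bochner
integrals of continuous curves or limits of such integrals.

The analytic core is one inequality, `integral_inner_mul_spectral_le`: a quadratic form whose kernel
is the cosine transform of a density with 0 ≤ f ≤ C is at most 2πC times the squared L₂ norm, also
for Hilbert-valued arguments. With scalar coefficients it makes the truncated responses Cauchy
uniformly in time and bounds the norm of the response `Y` by a constant R depending only on C, H and
`U`. By duality it also bounds ∫⟨v, X(s)⟩² ds.

By Isserlis' formula (`integral_mul_mul_mul`) the centred product Y(t+τ)X(t) has covariance
⟨y,y'⟩⟨x,x'⟩ + ⟨y,x'⟩⟨x,y'⟩. Integrated over [0,T]², the first term falls under the Hilbert-valued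
inequality and the second under its dual, so the integral of the centred product has squared norm at
most 4πCR²T. After division by (cT)² this is O(1/T), uniformly in Δ.

The mean of the estimator is c⁻¹∫H(s)K(τ-s) ds, with K the correlation function of `X`. It tends to
H(τ) because K behaves like c times an approximate identity: `tendsto_integral_corr` shows that its
mass tends to c, and `tendsto_integral_mul_corr` uses the balance conditions in place of positivity
or a uniform L₁ bound, neither of which is available. As the variance bound does not involve Δ and
the bias does not involve T, the joint limit follows. -/

lemma norm_riemannSum_sub_integral_le {E : Type*} [NormedAddCommGroup E] [NormedSpace ℝ E]
    [CompleteSpace E] {Φ : ℝ → E} (hΦ : Continuous Φ) {a b η δ : ℝ}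
    (h : ∀ s ∈ Set.Icc a b, ∀ t ∈ Set.Icc a b, |s - t| < δ → ‖Φ s - Φ t‖ ≤ η)
    {n : ℕ} {x ξ : ℕ → ℝ} (hx0 : x 0 = a) (hxn : x n = b)
    (hx : ∀ i < n, x i ≤ ξ i ∧ ξ i ≤ x (i + 1) ∧ x (i + 1) - x i < δ) :
    ‖(∑ i ∈ Finset.range n, (x (i + 1) - x i) • Φ (ξ i)) - ∫ t in a..b, Φ t‖ ≤ (b - a) * η := by
  have hmono : ∀ i j, i ≤ j → j ≤ n → x i ≤ x j := by
    intro i j hij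
    induction j, hij using Nat.le_induction with
    | base => intro _; exact le_rfl
    | succ j hj ih =>
      intro hjn
      have := hx j (by omega)
      exact (ih (by omega)).trans (this.1.trans this.2.1)
  have hsum : ∫ t in a..b, Φ t = ∑ i ∈ Finset.range n, ∫ t in x i..x (i + 1), Φ t := by
    rw [intervalIntegral.sum_integral_adjacent_intervals
      (fun k _ => hΦ.intervalIntegrable _ _), hx0, hxn]
  have hlen : (b - a) * η = ∑ i ∈ Finset.range n, η * |x (i + 1) - x i| := by
    have : ∑ i ∈ Finset.range n, η * |x (i + 1) - x i|
        = ∑ i ∈ Finset.range n, (η * x (i + 1) - η * x i) := by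
      refine Finset.sum_congr rfl fun i hi => ?_
      have hi' := Finset.mem_range.1 hi
      rw [abs_of_nonneg (sub_nonneg.2 (hmono i (i + 1) (by omega) (by omega)))]
      ring
    rw [this, Finset.sum_range_sub (fun i => η * x i), hx0, hxn]
    ring
  rw [hsum, ← Finset.sum_sub_distrib, hlen]
  refine norm_sum_le_of_le _ fun i hi => ?_
  have hi' := Finset.mem_range.1 hi
  have hxi := hx i hi'
  have heq : (x (i + 1) - x i) • Φ (ξ i) - ∫ t in x i..x (i + 1), Φ t
      = ∫ t in x i..x (i + 1), (Φ (ξ i) - Φ t) := by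
    rw [intervalIntegral.integral_sub (by simp) (hΦ.intervalIntegrable _ _)]
    simp
  rw [heq]
  have hle : x i ≤ x (i + 1) := hxi.1.trans hxi.2.1
  have h0 : a ≤ x i := hx0 ▸ hmono 0 i (by omega) (by omega)
  have h1 : x (i + 1) ≤ b := hxn ▸ hmono (i + 1) n (by omega) le_rfl
  refine intervalIntegral.norm_integral_le_of_norm_le_const fun t ht => ?_
  rw [Set.uIoc_of_le hle] at ht
  refine h _ ⟨by linarith, by linarith⟩ _ ⟨by linarith [ht.1], by linarith [ht.2]⟩ ?_
  rw [abs_lt]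
  constructor <;> linarith [ht.1, ht.2]

lemma exists_partition {a b δ : ℝ} (hab : a ≤ b) (hδ : 0 < δ) :
    ∃ (n : ℕ) (x : ℕ → ℝ), x 0 = a ∧ x n = b ∧
      ∀ i < n, x i ≤ x (i + 1) ∧ x (i + 1) - x i < δ := by
  obtain ⟨n, hn⟩ := exists_nat_gt ((b - a) / δ)
  refine ⟨n + 1, fun i => a + i * ((b - a) / (n + 1)), by simp, ?_, fun i _ => ?_⟩
  · have : (n : ℝ) + 1 ≠ 0 := by positivity
    push_cast
    field_simp
    ring
  · have h0 : 0 ≤ (b - a) / ((n : ℝ) + 1) := div_nonneg (by linarith) (by positivity)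
    have h1 : (b - a) / ((n : ℝ) + 1) < δ := by
      rw [div_lt_iff₀ (by positivity)]
      rw [div_lt_iff₀ hδ] at hn
      nlinarith
    push_cast
    constructor <;> nlinarith

variable {P : Measure Ω}

lemma eLpNorm_coe_sub (F G : Lp ℝ 2 P) :
    eLpNorm (fun ω => F ω - G ω) 2 P = ENNReal.ofReal ‖F - G‖ := by
  rw [Lp.norm_def, ENNReal.ofReal_toReal (Lp.eLpNorm_ne_top _)]
  exact eLpNorm_congr_ae (Lp.coeFn_sub F G).symm

lemma riemannSum_ae_eq {φ : ℝ → Ω → ℝ} {Φ : ℝ → Lp ℝ 2 P} (hφ : ∀ t, φ t =ᵐ[P] Φ t)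
    (n : ℕ) (x ξ : ℕ → ℝ) :
    (fun ω => ∑ i ∈ Finset.range n, (x (i + 1) - x i) * φ (ξ i) ω) =ᵐ[P]
      (∑ i ∈ Finset.range n, (x (i + 1) - x i) • Φ (ξ i) : Lp ℝ 2 P) := by
  induction n with
  | zero =>
    simp only [Finset.range_zero, Finset.sum_empty]
    exact (Lp.coeFn_zero ℝ 2 P).symm
  | succ n ih =>
    simp only [Finset.sum_range_succ]
    filter_upwards [ih, Lp.coeFn_add (∑ i ∈ Finset.range n, (x (i + 1) - x i) • Φ (ξ i))
      ((x (n + 1) - x n) • Φ (ξ n)), Lp.coeFn_smul (x (n + 1) - x n) (Φ (ξ n)), hφ (ξ n)]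
      with ω h1 h2 h3 h4
    rw [h2, Pi.add_apply, h3, h1, Pi.smul_apply, h4, smul_eq_mul]

lemma isMSRiemannIntegral_integral {φ : ℝ → Ω → ℝ} {Φ : ℝ → Lp ℝ 2 P} (hΦ : Continuous Φ)
    (hφ : ∀ t, φ t =ᵐ[P] Φ t) {a b : ℝ} (hab : a ≤ b) :
    IsMSRiemannIntegral P φ a b (∫ t in a..b, Φ t : Lp ℝ 2 P) := by
  refine ⟨hab, Lp.memLp _, fun ε hε => ?_⟩
  have huc := (isCompact_Icc (a := a) (b := b)).uniformContinuousOn_of_continuous hΦ.continuousOn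
  -- The added 1 keeps the denominator positive when a = b.
  have hη : 0 < ε / (b - a + 1) := div_pos hε (by linarith)
  obtain ⟨δ, hδ, h⟩ := Metric.uniformContinuousOn_iff.1 huc _ hη
  refine ⟨δ, hδ, fun n x ξ hx0 hxn hx => ?_⟩
  have h1 : (fun ω => (∑ i ∈ Finset.range n, (x (i + 1) - x i) * φ (ξ i) ω)
      - (∫ t in a..b, Φ t : Lp ℝ 2 P) ω) =ᵐ[P] fun ω =>
      (∑ i ∈ Finset.range n, (x (i + 1) - x i) • Φ (ξ i) : Lp ℝ 2 P) ω
      - (∫ t in a..b, Φ t : Lp ℝ 2 P) ω := by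
    filter_upwards [riemannSum_ae_eq hφ n x ξ] with ω hω
    rw [← hω]
  rw [eLpNorm_congr_ae h1, eLpNorm_coe_sub]
  refine ENNReal.ofReal_le_ofReal ?_
  refine (norm_riemannSum_sub_integral_le hΦ (η := ε / (b - a + 1)) (δ := δ) ?_ hx0 hxn hx).trans ?_
  · intro s hs t ht hst
    have := h s hs t ht (by rwa [Real.dist_eq])
    rw [dist_eq_norm] at this
    exact this.le
  · rw [mul_div_assoc', div_le_iff₀ (by linarith)]
    nlinarith

/-- Uniqueness of both kinds of mean-square integral comes down to two limits sharing common
approximants. It is needed because the integrals are selected by choice and must be identified with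
Bochner integrals. -/
lemma ae_eq_of_eLpNorm_le {I J : Ω → ℝ} (hI : AEStronglyMeasurable I P)
    (hJ : AEStronglyMeasurable J P)
    (h : ∀ ε : ℝ, 0 < ε → ∃ S : Ω → ℝ, AEStronglyMeasurable S P ∧
      eLpNorm (fun ω => S ω - I ω) 2 P ≤ ENNReal.ofReal ε ∧
      eLpNorm (fun ω => S ω - J ω) 2 P ≤ ENNReal.ofReal ε) : I =ᵐ[P] J := by
  have h0 : eLpNorm (J - I) 2 P = 0 := by
    refine le_antisymm (ENNReal.le_of_forall_pos_le_add fun ε hε _ => ?_) zero_le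
    obtain ⟨S, hS, hSI, hSJ⟩ := h (ε / 2) (by positivity)
    have heq : J - I = (fun ω => S ω - I ω) - fun ω => S ω - J ω := by
      ext ω; simp
    rw [heq, zero_add]
    refine (eLpNorm_sub_le (hS.sub hI) (hS.sub hJ) one_le_two).trans ?_
    refine (add_le_add hSI hSJ).trans ?_
    rw [← ENNReal.ofReal_add (by positivity) (by positivity), add_halves, ENNReal.ofReal_coe_nnreal]
  rw [eLpNorm_eq_zero_iff (hJ.sub hI) two_ne_zero] at h0
  filter_upwards [h0] with ω hω
  simp only [Pi.sub_apply, Pi.zero_apply] at hω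
  linarith

lemma IsMSRiemannIntegral.ae_eq {φ : ℝ → Ω → ℝ} (hφ : ∀ t, AEStronglyMeasurable (φ t) P)
    {a b : ℝ} {I J : Ω → ℝ} (hI : IsMSRiemannIntegral P φ a b I)
    (hJ : IsMSRiemannIntegral P φ a b J) : I =ᵐ[P] J := by
  refine ae_eq_of_eLpNorm_le hI.2.1.1 hJ.2.1.1 fun ε hε => ?_
  obtain ⟨δ, hδ, h⟩ := hI.2.2 ε hε
  obtain ⟨δ', hδ', h'⟩ := hJ.2.2 ε hε
  obtain ⟨n, x, hx0, hxn, hx⟩ := exists_partition hI.1 (lt_min hδ hδ')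
  refine ⟨fun ω => ∑ i ∈ Finset.range n, (x (i + 1) - x i) * φ (x i) ω, ?_,
    h n x x hx0 hxn fun i hi => ⟨le_rfl, (hx i hi).1, (hx i hi).2.trans_le (min_le_left _ _)⟩,
    h' n x x hx0 hxn fun i hi => ⟨le_rfl, (hx i hi).1, (hx i hi).2.trans_le (min_le_right _ _)⟩⟩
  exact Finset.aestronglyMeasurable_fun_sum _ fun i _ => (hφ _).const_mul _

lemma msRiemannIntegral_ae_eq {φ : ℝ → Ω → ℝ} {Φ : ℝ → Lp ℝ 2 P} (hΦ : Continuous Φ)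
    (hφ : ∀ t, φ t =ᵐ[P] Φ t) {a b : ℝ} (hab : a ≤ b) :
    msRiemannIntegral P φ a b =ᵐ[P] (∫ t in a..b, Φ t : Lp ℝ 2 P) := by
  have hI := isMSRiemannIntegral_integral hΦ hφ hab
  have hex : ∃ I, IsMSRiemannIntegral P φ a b I := ⟨_, hI⟩
  rw [msRiemannIntegral, dif_pos hex]
  exact hex.choose_spec.ae_eq (fun t => (Lp.aestronglyMeasurable _).congr (hφ t).symm) hI

lemma isMSIntegral_of_tendsto {φ : ℝ → Ω → ℝ} {Φ : ℝ → Lp ℝ 2 P} (hΦ : Continuous Φ)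
    (hφ : ∀ t, φ t =ᵐ[P] Φ t) {z : Lp ℝ 2 P}
    (hz : Tendsto (fun p : ℝ × ℝ => ∫ t in p.1..p.2, Φ t) (atBot ×ˢ atTop) (𝓝 z)) :
    IsMSIntegral P φ z := by
  refine ⟨Lp.memLp _, fun a b => (∫ t in a..b, Φ t : Lp ℝ 2 P), fun a b hab =>
    isMSRiemannIntegral_integral hΦ hφ hab, ?_⟩
  simp_rw [eLpNorm_coe_sub]
  rw [← ENNReal.ofReal_zero]
  exact (ENNReal.continuous_ofReal.tendsto 0).comp (tendsto_iff_norm_sub_tendsto_zero.1 hz)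

lemma eventually_atBot_prod_atTop_le : ∀ᶠ p : ℝ × ℝ in atBot ×ˢ atTop, p.1 ≤ p.2 := by
  filter_upwards [(eventually_le_atBot (0 : ℝ)).prod_mk (eventually_ge_atTop (0 : ℝ))] with p hp
  exact hp.1.trans hp.2

lemma IsMSIntegral.ae_eq {φ : ℝ → Ω → ℝ} (hφ : ∀ t, AEStronglyMeasurable (φ t) P)
    {I I' : Ω → ℝ} (hI : IsMSIntegral P φ I) (hI' : IsMSIntegral P φ I') : I =ᵐ[P] I' := by
  obtain ⟨hI2, J, hJ, hJlim⟩ := hI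
  obtain ⟨hI2', J', hJ', hJlim'⟩ := hI'
  refine ae_eq_of_eLpNorm_le hI2.1 hI2'.1 fun ε hε => ?_
  have hpos : 0 < ENNReal.ofReal ε := ENNReal.ofReal_pos.2 hε
  obtain ⟨p, hp, hp1, hp2⟩ := (eventually_atBot_prod_atTop_le.and
    ((hJlim.eventually (ge_mem_nhds hpos)).and (hJlim'.eventually (ge_mem_nhds hpos)))).exists
  have hae := (hJ _ _ hp).ae_eq hφ (hJ' _ _ hp)
  refine ⟨J p.1 p.2, (hJ _ _ hp).2.1.1, hp1, ?_⟩
  refine (eLpNorm_congr_ae ?_).trans_le hp2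
  filter_upwards [hae] with ω hω
  rw [hω]

lemma msIntegral_ae_eq {φ : ℝ → Ω → ℝ} {Φ : ℝ → Lp ℝ 2 P} (hΦ : Continuous Φ)
    (hφ : ∀ t, φ t =ᵐ[P] Φ t) {z : Lp ℝ 2 P}
    (hz : Tendsto (fun p : ℝ × ℝ => ∫ t in p.1..p.2, Φ t) (atBot ×ˢ atTop) (𝓝 z)) :
    msIntegral P φ =ᵐ[P] z := by
  have hI := isMSIntegral_of_tendsto hΦ hφ hz
  have hex : ∃ I, IsMSIntegral P φ I := ⟨_, hI⟩
  rw [msIntegral, dif_pos hex]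
  exact hex.choose_spec.ae_eq (fun t => (Lp.aestronglyMeasurable _).congr (hφ t).symm) hI

end Riemann

/-! ### Quadratic forms with a bounded spectral density -/

section Spectral

open RealInnerProductSpace

lemma integrable_cos_mul {f : ℝ → ℝ} (hf : Integrable f) (u : ℝ) :
    Integrable fun l => Real.cos (l * u) * f l := by
  refine hf.bdd_mul (c := 1) (by fun_prop) (Eventually.of_forall fun l => ?_)
  simpa using Real.abs_cos_le_one (l * u)

/-- The cosine transform of a Gaussian. -/
lemma integral_cos_mul_gaussian {ε : ℝ} (hε : 0 < ε) (u : ℝ) :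
    ∫ l : ℝ, Real.cos (l * u) * Real.exp (-ε * l ^ 2)
      = √(Real.pi / ε) * Real.exp (-(1 / (4 * ε)) * u ^ 2) := by
  have h := fourierIntegral_gaussian (b := (ε : ℂ)) (by simpa using hε) (u : ℂ)
  have hre := congrArg Complex.re h
  have hint : Integrable fun x : ℝ =>
      Complex.exp (Complex.I * u * x) * Complex.exp (-(ε : ℂ) * x ^ 2) := by
    have := (integrable_cexp_neg_mul_sq (b := (ε : ℂ)) (by simpa using hε))
    refine this.bdd_mul (c := 1) (by fun_prop) (Eventually.of_forall fun x => ?_)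
    rw [show Complex.I * (u : ℂ) * x = ((u * x : ℝ) : ℂ) * Complex.I by push_cast; ring,
      Complex.norm_exp_ofReal_mul_I]
  have hre' : (∫ x : ℝ, Complex.exp (Complex.I * u * x) * Complex.exp (-(ε : ℂ) * x ^ 2)).re
      = ∫ x : ℝ, (Complex.exp (Complex.I * u * x) * Complex.exp (-(ε : ℂ) * x ^ 2)).re :=
    (integral_re hint).symm
  rw [hre'] at hre
  convert hre using 1
  · refine integral_congr_ae (Eventually.of_forall fun x => ?_)
    simp only
    rw [show -(ε : ℂ) * (x : ℂ) ^ 2 = ((-ε * x ^ 2 : ℝ) : ℂ) by push_cast; ring,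
      ← Complex.ofReal_exp, Complex.re_mul_ofReal,
      show Complex.I * (u : ℂ) * x = ((x * u : ℝ) : ℂ) * Complex.I by push_cast; ring,
      Complex.exp_ofReal_mul_I_re]
  · rw [show -(u : ℂ) ^ 2 / (4 * ε) = ((-(1 / (4 * ε)) * u ^ 2 : ℝ) : ℂ) by push_cast; ring,
      ← Complex.ofReal_exp, Complex.re_mul_ofReal,
      show (Real.pi : ℂ) / ε = ((Real.pi / ε : ℝ) : ℂ) by push_cast; ring,
      show (1 / 2 : ℂ) = ((1 / 2 : ℝ) : ℂ) by push_cast; ring,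
      ← Complex.ofReal_cpow (by positivity), Complex.ofReal_re, Real.sqrt_eq_rpow]

lemma integral_gaussian_kernel {ε : ℝ} (hε : 0 < ε) :
    ∫ u : ℝ, √(Real.pi / ε) * Real.exp (-(1 / (4 * ε)) * u ^ 2) = 2 * Real.pi := by
  rw [integral_const_mul, integral_gaussian, ← Real.sqrt_mul (by positivity),
    show Real.pi / ε * (Real.pi / (1 / (4 * ε))) = (2 * Real.pi) ^ 2 by field_simp; ring]
  exact Real.sqrt_sq (by positivity)

variable {E : Type*} [NormedAddCommGroup E] [InnerProductSpace ℝ E] {μ : Measure ℝ}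

lemma integrable_inner_prod [SFinite μ] {y : ℝ → E} (hy : Integrable y μ) :
    Integrable (fun p : ℝ × ℝ => ⟪y p.1, y p.2⟫) (μ.prod μ) := by
  refine (hy.norm.mul_prod hy.norm).mono
    (hy.aestronglyMeasurable.comp_fst.inner hy.aestronglyMeasurable.comp_snd)
    (Eventually.of_forall fun p => ?_)
  rw [norm_mul, norm_norm, norm_norm]
  exact norm_inner_le_norm _ _

lemma norm_sq_integral [CompleteSpace E] [SFinite μ] {y : ℝ → E} (hy : Integrable y μ) :
    ‖∫ s, y s ∂μ‖ ^ 2 = ∫ p : ℝ × ℝ, ⟪y p.1, y p.2⟫ ∂μ.prod μ := by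
  rw [integral_prod _ (integrable_inner_prod hy)]
  simp_rw [integral_inner hy]
  rw [← real_inner_self_eq_norm_sq, ← integral_inner hy]
  exact integral_congr_ae (Eventually.of_forall fun s => real_inner_comm _ _)

/-- The addition formula for the cosine splits the form into squared norms of the cosine and sine
transforms of `y`. This positivity is what allows f to be replaced by its upper bound C under the
integral. -/
lemma integral_inner_mul_cos_nonneg [CompleteSpace E] [SFinite μ] {y : ℝ → E}
    (hy : Integrable y μ) (l : ℝ) :
    0 ≤ ∫ p : ℝ × ℝ, ⟪y p.1, y p.2⟫ * Real.cos (l * (p.1 - p.2)) ∂μ.prod μ := by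
  have hc : Integrable (fun s => Real.cos (l * s) • y s) μ := by
    refine hy.bdd_smul 1 (by fun_prop) (Eventually.of_forall fun s => ?_)
    simpa using Real.abs_cos_le_one _
  have hs : Integrable (fun s => Real.sin (l * s) • y s) μ := by
    refine hy.bdd_smul 1 (by fun_prop) (Eventually.of_forall fun s => ?_)
    simpa using Real.abs_sin_le_one _
  have : ∫ p : ℝ × ℝ, ⟪y p.1, y p.2⟫ * Real.cos (l * (p.1 - p.2)) ∂μ.prod μ
      = ‖∫ s, Real.cos (l * s) • y s ∂μ‖ ^ 2 + ‖∫ s, Real.sin (l * s) • y s ∂μ‖ ^ 2 := by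
    rw [norm_sq_integral hc, norm_sq_integral hs,
      ← integral_add (integrable_inner_prod hc) (integrable_inner_prod hs)]
    refine integral_congr_ae (Eventually.of_forall fun p => ?_)
    simp only [mul_sub, Real.cos_sub, real_inner_smul_left, real_inner_smul_right]
    ring
  rw [this]
  positivity

/-- Fubini for a quadratic form whose kernel is a cosine transform. -/
lemma integral_spectral_swap [SFinite μ] {y : ℝ → E} (hy : Integrable y μ) {w : ℝ → ℝ}
    (hw : Integrable w) :
    ∫ p : ℝ × ℝ, ⟪y p.1, y p.2⟫ * (∫ l, Real.cos (l * (p.1 - p.2)) * w l) ∂μ.prod μ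
      = ∫ l, w l * ∫ p : ℝ × ℝ, ⟪y p.1, y p.2⟫ * Real.cos (l * (p.1 - p.2)) ∂μ.prod μ := by
  have hint : Integrable (Function.uncurry fun (p : ℝ × ℝ) (l : ℝ) =>
      Real.cos (l * (p.1 - p.2)) * (⟪y p.1, y p.2⟫ * w l)) ((μ.prod μ).prod volume) := by
    refine ((integrable_inner_prod hy).mul_prod hw).bdd_mul (c := 1) ?_
      (Eventually.of_forall fun s => ?_)
    · exact Continuous.aestronglyMeasurable (by fun_prop)
    · simpa using Real.abs_cos_le_one _
  have := integral_integral_swap hint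
  simp_rw [← integral_const_mul]
  refine Eq.trans ?_ (this.trans ?_)
  · refine integral_congr_ae (Eventually.of_forall fun p => ?_)
    refine integral_congr_ae (Eventually.of_forall fun l => ?_)
    simp only
    ring
  · refine integral_congr_ae (Eventually.of_forall fun p => ?_)
    refine integral_congr_ae (Eventually.of_forall fun l => ?_)
    simp only
    ring

/-- Schur's test for a nonnegative convolution kernel. -/
lemma integral_inner_mul_kernel_le [IsFiniteMeasure μ] (hμ : μ ≤ volume) {y : ℝ → E}
    (hy : Integrable y μ) (hy2 : Integrable (fun s => ‖y s‖ ^ 2) μ) {G : ℝ → ℝ}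
    (hG0 : ∀ u, 0 ≤ G u) (hGc : Continuous G) (hGe : ∀ u, G (-u) = G u) {D : ℝ}
    (hGD : ∀ u, G u ≤ D) (hGi : Integrable G) :
    ∫ p : ℝ × ℝ, ⟪y p.1, y p.2⟫ * G (p.1 - p.2) ∂μ.prod μ
      ≤ (∫ u, G u) * ∫ s, ‖y s‖ ^ 2 ∂μ := by
  have hGb : ∀ᵐ p : ℝ × ℝ ∂μ.prod μ, ‖G (p.1 - p.2)‖ ≤ D := Eventually.of_forall fun p => by
    rw [Real.norm_of_nonneg (hG0 _)]; exact hGD _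
  have hGm : AEStronglyMeasurable (fun p : ℝ × ℝ => G (p.1 - p.2)) (μ.prod μ) :=
    Continuous.aestronglyMeasurable (by fun_prop)
  have h1 : Integrable (fun p : ℝ × ℝ => ‖y p.1‖ ^ 2 * G (p.1 - p.2)) (μ.prod μ) :=
    (hy2.comp_fst μ).mul_bdd hGm hGb
  have h2 : Integrable (fun p : ℝ × ℝ => ‖y p.2‖ ^ 2 * G (p.1 - p.2)) (μ.prod μ) :=
    (hy2.comp_snd μ).mul_bdd hGm hGb
  have h0 : Integrable (fun p : ℝ × ℝ => ⟪y p.1, y p.2⟫ * G (p.1 - p.2)) (μ.prod μ) :=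
    (integrable_inner_prod hy).mul_bdd hGm hGb
  have hinner : ∀ s, ∫ t, G (s - t) ∂μ ≤ ∫ u, G u := fun s => by
    have hi : Integrable fun t => G (s - t) := hGi.comp_sub_left s
    calc ∫ t, G (s - t) ∂μ ≤ ∫ t, G (s - t) :=
          integral_mono_measure hμ (Eventually.of_forall fun t => hG0 _) hi
      _ = ∫ u, G u := integral_sub_left_eq_self G volume s
  have hfst : ∫ p : ℝ × ℝ, ‖y p.1‖ ^ 2 * G (p.1 - p.2) ∂μ.prod μ
      ≤ (∫ u, G u) * ∫ s, ‖y s‖ ^ 2 ∂μ := by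
    rw [integral_prod _ h1, ← integral_const_mul]
    refine integral_mono h1.integral_prod_left (hy2.const_mul _) fun s => ?_
    simp only
    rw [integral_const_mul, mul_comm]
    exact mul_le_mul_of_nonneg_right (hinner s) (by positivity)
  have hsnd : ∫ p : ℝ × ℝ, ‖y p.2‖ ^ 2 * G (p.1 - p.2) ∂μ.prod μ
      = ∫ p : ℝ × ℝ, ‖y p.1‖ ^ 2 * G (p.1 - p.2) ∂μ.prod μ := by
    rw [← integral_prod_swap]
    refine integral_congr_ae (Eventually.of_forall fun p => ?_)
    simp only [Prod.fst_swap, Prod.snd_swap]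
    rw [← hGe, neg_sub]
  calc ∫ p : ℝ × ℝ, ⟪y p.1, y p.2⟫ * G (p.1 - p.2) ∂μ.prod μ
      ≤ ∫ p : ℝ × ℝ, (1 / 2) * (‖y p.1‖ ^ 2 * G (p.1 - p.2) + ‖y p.2‖ ^ 2 * G (p.1 - p.2))
          ∂μ.prod μ := by
        refine integral_mono h0 ((h1.add h2).const_mul _) fun p => ?_
        simp only
        have hin : ⟪y p.1, y p.2⟫ ≤ (1 / 2) * (‖y p.1‖ ^ 2 + ‖y p.2‖ ^ 2) := by
          have := real_inner_le_norm (y p.1) (y p.2)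
          nlinarith [sq_nonneg (‖y p.1‖ - ‖y p.2‖)]
        have := mul_le_mul_of_nonneg_right hin (hG0 (p.1 - p.2))
        linarith
    _ = ∫ p : ℝ × ℝ, ‖y p.1‖ ^ 2 * G (p.1 - p.2) ∂μ.prod μ := by
        rw [integral_const_mul, integral_add h1 h2, hsnd]; ring
    _ ≤ _ := hfst

/-- A quadratic form with spectral density at most `C` is bounded by `2πC` times the squared
`L₂` norm. -/
lemma integral_inner_mul_spectral_le [CompleteSpace E] [IsFiniteMeasure μ] (hμ : μ ≤ volume)
    {y : ℝ → E} (hy : Integrable y μ) (hy2 : Integrable (fun s => ‖y s‖ ^ 2) μ) {f : ℝ → ℝ}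
    {C : ℝ} (hf : Integrable f) (hf0 : ∀ l, 0 ≤ f l) (hfC : ∀ l, f l ≤ C) :
    ∫ p : ℝ × ℝ, ⟪y p.1, y p.2⟫ * (∫ l, Real.cos (l * (p.1 - p.2)) * f l) ∂μ.prod μ
      ≤ 2 * Real.pi * C * ∫ s, ‖y s‖ ^ 2 ∂μ := by
  have hC : 0 ≤ C := (hf0 0).trans (hfC 0)
  rw [integral_spectral_swap hy hf]
  set q : ℝ → ℝ := fun l =>
    ∫ p : ℝ × ℝ, ⟪y p.1, y p.2⟫ * Real.cos (l * (p.1 - p.2)) ∂μ.prod μ with hq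
  have hq0 : ∀ l, 0 ≤ q l := integral_inner_mul_cos_nonneg hy
  have hqi := integrable_inner_prod hy
  set D : ℝ := ∫ p : ℝ × ℝ, ‖⟪y p.1, y p.2⟫‖ ∂μ.prod μ with hD
  have hbound : ∀ l (p : ℝ × ℝ), ‖⟪y p.1, y p.2⟫ * Real.cos (l * (p.1 - p.2))‖
      ≤ ‖⟪y p.1, y p.2⟫‖ := fun l p => by
    rw [norm_mul]
    exact mul_le_of_le_one_right (norm_nonneg _) (Real.abs_cos_le_one _)
  have hqD : ∀ l, ‖q l‖ ≤ D := fun l =>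
    norm_integral_le_of_norm_le hqi.norm (Eventually.of_forall (hbound l))
  have hqc : Continuous q := by
    refine continuous_of_dominated (fun l => ?_) (fun l => Eventually.of_forall (hbound l))
      hqi.norm (Eventually.of_forall fun p => by fun_prop)
    exact hqi.aestronglyMeasurable.mul (Continuous.aestronglyMeasurable (by fun_prop))
  -- `q` is known to be bounded but not integrable, so f ≤ C is used under a Gaussian damping
  -- factor. Undoing the transform turns that factor into a Gaussian convolution kernel of mass 2π
  -- for every ε, to which Schur's test applies.
  have hreg : ∀ ε : ℝ, 0 < ε → ∫ l, Real.exp (-ε * l ^ 2) * (f l * q l)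
      ≤ 2 * Real.pi * C * ∫ s, ‖y s‖ ^ 2 ∂μ := by
    intro ε hε
    have hgi := integrable_exp_neg_mul_sq hε
    have hgq : Integrable fun l => Real.exp (-ε * l ^ 2) * q l :=
      hgi.mul_bdd hqc.aestronglyMeasurable (Eventually.of_forall hqD)
    calc ∫ l, Real.exp (-ε * l ^ 2) * (f l * q l)
        ≤ ∫ l, C * (Real.exp (-ε * l ^ 2) * q l) := by
          refine integral_mono ?_ (hgq.const_mul C) fun l => ?_
          · refine (hf.mul_bdd hqc.aestronglyMeasurable (Eventually.of_forall hqD)).bdd_mul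
              (c := 1) (by fun_prop) (Eventually.of_forall fun l => ?_)
            rw [Real.norm_of_nonneg (Real.exp_pos _).le, Real.exp_le_one_iff]
            nlinarith [sq_nonneg l]
          · have := mul_le_mul_of_nonneg_right (hfC l)
              (mul_nonneg (Real.exp_pos (-ε * l ^ 2)).le (hq0 l))
            simp only
            linarith
      _ = C * ∫ p : ℝ × ℝ, ⟪y p.1, y p.2⟫ *
            (√(Real.pi / ε) * Real.exp (-(1 / (4 * ε)) * (p.1 - p.2) ^ 2)) ∂μ.prod μ := by
          rw [integral_const_mul, ← integral_spectral_swap hy hgi]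
          simp_rw [integral_cos_mul_gaussian hε]
      _ ≤ C * (2 * Real.pi * ∫ s, ‖y s‖ ^ 2 ∂μ) := by
          refine mul_le_mul_of_nonneg_left ?_ hC
          rw [← integral_gaussian_kernel hε]
          refine integral_inner_mul_kernel_le (D := √(Real.pi / ε)) hμ hy hy2
            (G := fun u => √(Real.pi / ε) * Real.exp (-(1 / (4 * ε)) * u ^ 2))
            (fun u => by positivity) (by fun_prop) (fun u => by simp only [neg_sq]) (fun u => ?_)
            ((integrable_exp_neg_mul_sq (by positivity)).const_mul _)
          refine mul_le_of_le_one_right (Real.sqrt_nonneg _) (Real.exp_le_one_iff.2 ?_)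
          have : 0 ≤ 1 / (4 * ε) * u ^ 2 := by positivity
          linarith
      _ = _ := by ring
  have hlim : Tendsto (fun ε : ℝ => ∫ l, Real.exp (-ε * l ^ 2) * (f l * q l)) (𝓝[>] 0)
      (𝓝 (∫ l, f l * q l)) := by
    have hfq := hf.mul_bdd hqc.aestronglyMeasurable (Eventually.of_forall hqD)
    refine tendsto_integral_filter_of_dominated_convergence (fun l => ‖f l * q l‖) ?_ ?_
      hfq.norm ?_
    · exact Eventually.of_forall fun ε =>
        (Continuous.aestronglyMeasurable (by fun_prop)).mul hfq.aestronglyMeasurable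
    · filter_upwards [self_mem_nhdsWithin] with ε hε
      refine Eventually.of_forall fun l => ?_
      rw [norm_mul]
      refine mul_le_of_le_one_left (norm_nonneg _) ?_
      rw [Real.norm_of_nonneg (Real.exp_pos _).le, Real.exp_le_one_iff]
      have : (0 : ℝ) < ε := hε
      nlinarith [sq_nonneg l]
    · refine Eventually.of_forall fun l => ?_
      have : Tendsto (fun ε : ℝ => Real.exp (-ε * l ^ 2) * (f l * q l)) (𝓝 0)
          (𝓝 (Real.exp (-0 * l ^ 2) * (f l * q l))) :=
        Continuous.tendsto (by fun_prop) 0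
      simp only [neg_zero, zero_mul, Real.exp_zero, one_mul] at this
      exact this.mono_left nhdsWithin_le_nhds
  exact le_of_tendsto hlim (by filter_upwards [self_mem_nhdsWithin] with ε hε using hreg ε hε)

lemma restrict_Ioc_facts {F : Type*} [NormedAddCommGroup F] {y : ℝ → F} (hy : Continuous y)
    (a b : ℝ) : Integrable y (volume.restrict (Set.Ioc a b)) ∧
      Integrable (fun s => ‖y s‖ ^ 2) (volume.restrict (Set.Ioc a b)) :=
  ⟨hy.integrableOn_Ioc, Continuous.integrableOn_Ioc (by fun_prop)⟩

/-- The process `x` has correlation function `∫ cos(l u) f(l) dl`, with `0 ≤ f ≤ C`. -/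
structure HasBoundedSpectrum (x : ℝ → E) (f : ℝ → ℝ) (C : ℝ) : Prop where
  cont : Continuous x
  integrable : Integrable f
  nonneg : ∀ l, 0 ≤ f l
  le : ∀ l, f l ≤ C
  inner_eq : ∀ s t, ⟪x s, x t⟫ = ∫ l, Real.cos (l * (s - t)) * f l

namespace HasBoundedSpectrum

variable {x : ℝ → E} {f : ℝ → ℝ} {C : ℝ}

lemma bound_nonneg (h : HasBoundedSpectrum x f C) : 0 ≤ C := (h.nonneg 0).trans (h.le 0)

lemma comp_sub_left (h : HasBoundedSpectrum x f C) (t : ℝ) :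
    HasBoundedSpectrum (fun s => x (t - s)) f C where
  cont := h.cont.comp (by fun_prop)
  integrable := h.integrable
  nonneg := h.nonneg
  le := h.le
  inner_eq s s' := by
    rw [h.inner_eq]
    refine integral_congr_ae (Eventually.of_forall fun l => ?_)
    simp only
    rw [show l * (t - s - (t - s')) = -(l * (s - s')) by ring, Real.cos_neg]

/-- The general inequality is used here with the scalar function φ as its argument; the Hilbert
space enters only through the kernel ⟨x s, x t⟩. -/
lemma norm_sq_integral_smul_le [CompleteSpace E] (h : HasBoundedSpectrum x f C) {φ : ℝ → ℝ}
    (hφ : Continuous φ) {a b : ℝ} (hab : a ≤ b) :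
    ‖∫ s in a..b, φ s • x s‖ ^ 2 ≤ 2 * Real.pi * C * ∫ s in a..b, φ s ^ 2 := by
  rw [intervalIntegral.integral_of_le hab, intervalIntegral.integral_of_le hab]
  have hx := h.cont
  rw [norm_sq_integral (restrict_Ioc_facts (by fun_prop) a b).1]
  have hb := integral_inner_mul_spectral_le (μ := volume.restrict (Set.Ioc a b))
    Measure.restrict_le_self (restrict_Ioc_facts hφ a b).1 (restrict_Ioc_facts hφ a b).2
    h.integrable h.nonneg h.le
  simp only [Real.norm_eq_abs, sq_abs] at hb
  refine Eq.trans_le ?_ hb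
  refine integral_congr_ae (Eventually.of_forall fun p => ?_)
  simp only [real_inner_smul_left, real_inner_smul_right, h.inner_eq, RCLike.inner_apply,
    conj_trivial]
  ring

/-- The map v ↦ ⟨v, x(·)⟩ is adjoint to φ ↦ ∫φx, so it has the same operator bound. Concretely, φ =
⟨v, x(·)⟩ is inserted in the previous bound and one factor A is cancelled, which is why A = 0 is
treated separately. -/
lemma integral_inner_sq_le [CompleteSpace E] (h : HasBoundedSpectrum x f C) (v : E) {a b : ℝ}
    (hab : a ≤ b) : ∫ s in a..b, ⟪v, x s⟫ ^ 2 ≤ 2 * Real.pi * C * ‖v‖ ^ 2 := by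
  have hx := h.cont
  have hφ : Continuous fun s => ⟪v, x s⟫ := by fun_prop
  have h1 := h.norm_sq_integral_smul_le hφ hab
  set A := ∫ s in a..b, ⟪v, x s⟫ ^ 2 with hA
  have hA0 : 0 ≤ A := intervalIntegral.integral_nonneg hab fun s _ => sq_nonneg _
  have h2 : A = ⟪v, ∫ s in a..b, ⟪v, x s⟫ • x s⟫ := by
    rw [hA, intervalIntegral.integral_of_le hab, intervalIntegral.integral_of_le hab,
      ← integral_inner (restrict_Ioc_facts (by fun_prop) a b).1]
    refine integral_congr_ae (Eventually.of_forall fun p => ?_)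
    simp only [real_inner_smul_right]
    ring
  have h3 : A ≤ ‖v‖ * ‖∫ s in a..b, ⟪v, x s⟫ • x s‖ := h2.trans_le (real_inner_le_norm _ _)
  rcases hA0.eq_or_lt with h0 | h0
  · rw [← h0]
    have := h.bound_nonneg
    positivity
  · have h4 : A ^ 2 ≤ ‖v‖ ^ 2 * (2 * Real.pi * C * A) := by
      calc A ^ 2 ≤ (‖v‖ * ‖∫ s in a..b, ⟪v, x s⟫ • x s‖) ^ 2 := by gcongr
        _ = ‖v‖ ^ 2 * ‖∫ s in a..b, ⟪v, x s⟫ • x s‖ ^ 2 := by ring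
        _ ≤ _ := by gcongr
    have h5 : A * A ≤ (2 * Real.pi * C * ‖v‖ ^ 2) * A := by nlinarith
    exact le_of_mul_le_mul_right h5 h0

end HasBoundedSpectrum

end Spectral

/-! ### Approximate identities: the total mass of the kernel and the bias -/

section Kernel

lemma IsSpectralDensity.eq_cos {f K : ℝ → ℝ} (h : IsSpectralDensity f K) (t : ℝ) :
    K t = ∫ l, Real.cos (l * t) * f l := by
  have hint : Integrable fun l : ℝ => Complex.exp (Complex.I * l * t) * (f l : ℂ) := by
    refine h.integrable.ofReal.bdd_mul (c := 1) (by fun_prop) (Eventually.of_forall fun x => ?_)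
    rw [show Complex.I * (x : ℂ) * t = ((x * t : ℝ) : ℂ) * Complex.I by push_cast; ring,
      Complex.norm_exp_ofReal_mul_I]
  have hre := congrArg Complex.re (h.corr_eq t)
  have hre' : (∫ l : ℝ, Complex.exp (Complex.I * l * t) * (f l : ℂ)).re
      = ∫ l : ℝ, (Complex.exp (Complex.I * l * t) * (f l : ℂ)).re :=
    (integral_re hint).symm
  rw [Complex.ofReal_re, hre'] at hre
  rw [hre]
  refine integral_congr_ae (Eventually.of_forall fun x => ?_)
  simp only
  rw [Complex.re_mul_ofReal,
    show Complex.I * (x : ℂ) * t = ((x * t : ℝ) : ℂ) * Complex.I by push_cast; ring,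
    Complex.exp_ofReal_mul_I_re]

lemma IsSpectralDensity.even {f K : ℝ → ℝ} (h : IsSpectralDensity f K) (t : ℝ) :
    K (-t) = K t := by
  simp only [h.eq_cos, mul_neg, Real.cos_neg]

lemma IsSpectralDensity.continuous {f K : ℝ → ℝ} (h : IsSpectralDensity f K) :
    Continuous K := by
  rw [show K = fun t => ∫ l, Real.cos (l * t) * f l from funext h.eq_cos]
  refine continuous_of_dominated (bound := fun l => ‖f l‖)
    (fun t => (integrable_cos_mul h.integrable t).aestronglyMeasurable)
    (fun t => Eventually.of_forall fun l => ?_) h.integrable.norm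
    (Eventually.of_forall fun l => by fun_prop)
  rw [norm_mul]
  exact mul_le_of_le_one_left (norm_nonneg _) (Real.abs_cos_le_one _)

lemma IsSpectralDensity.norm_le {f K : ℝ → ℝ} (h : IsSpectralDensity f K) (t : ℝ) :
    ‖K t‖ ≤ ∫ l, ‖f l‖ := by
  rw [h.eq_cos]
  refine norm_integral_le_of_norm_le h.integrable.norm (Eventually.of_forall fun l => ?_)
  rw [norm_mul]
  exact mul_le_of_le_one_left (norm_nonneg _) (Real.abs_cos_le_one _)

lemma IsSpectralDensity.memLp_two {f K : ℝ → ℝ} (h : IsSpectralDensity f K)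
    (hK : Integrable K) : MemLp K 2 volume := by
  rw [memLp_two_iff_integrable_sq hK.aestronglyMeasurable]
  simp only [sq]
  exact hK.bdd_mul hK.aestronglyMeasurable (Eventually.of_forall h.norm_le)

/-- This is the multiplication formula for Fourier transforms, tested against a Gaussian. It allows
∫K to be computed with no continuity assumption on f. -/
lemma IsSpectralDensity.integral_mul_gaussian {f K : ℝ → ℝ} (h : IsSpectralDensity f K)
    {ε : ℝ} (hε : 0 < ε) :
    ∫ t, K t * Real.exp (-ε * t ^ 2)
      = ∫ l, f l * (√(Real.pi / ε) * Real.exp (-(1 / (4 * ε)) * l ^ 2)) := by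
  have hint : Integrable (Function.uncurry fun (t l : ℝ) =>
      Real.cos (l * t) * (Real.exp (-ε * t ^ 2) * f l)) (volume.prod volume) := by
    refine ((integrable_exp_neg_mul_sq hε).mul_prod h.integrable).bdd_mul (c := 1) ?_
      (Eventually.of_forall fun s => ?_)
    · exact Continuous.aestronglyMeasurable (by fun_prop)
    · simpa using Real.abs_cos_le_one _
  refine Eq.trans ?_ ((integral_integral_swap hint).trans ?_)
  · refine integral_congr_ae (Eventually.of_forall fun t => ?_)
    simp only
    rw [h.eq_cos, ← integral_mul_const]
    refine integral_congr_ae (Eventually.of_forall fun l => ?_)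
    simp only
    ring
  · refine integral_congr_ae (Eventually.of_forall fun l => ?_)
    simp only
    rw [← integral_cos_mul_gaussian hε, ← integral_const_mul]
    refine integral_congr_ae (Eventually.of_forall fun t => ?_)
    simp only
    rw [mul_comm t l]
    ring

/-- The integral of a correlation function is close to `2π` times the value near `0` of a bounded
spectral density. -/
lemma IsSpectralDensity.abs_integral_sub_le {f K : ℝ → ℝ} (h : IsSpectralDensity f K)
    (hK : Integrable K) {C c η : ℝ} (hc : 0 ≤ c) (hη : 0 ≤ η) (hC : ∀ l, |f l| ≤ C)
    (hf : ∀ l ∈ Set.Icc (-1 : ℝ) 1, |f l - c / (2 * Real.pi)| ≤ η) :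
    |(∫ t, K t) - c| ≤ 2 * Real.pi * η := by
  have hpi := Real.pi_pos
  set D : ℝ := C + c / (2 * Real.pi) with hD
  have hD0 : 0 ≤ D := add_nonneg ((abs_nonneg _).trans (hC 0)) (by positivity)
  -- Outside [-1, 1] only boundedness of f is known, but there l² ≥ 1, so a quadratic term absorbs
  -- the difference. Its contribution vanishes because the second moment of the Gaussian kernel is
  -- O(ε).
  have hpt : ∀ l, |f l - c / (2 * Real.pi)| ≤ η + D * l ^ 2 := by
    intro l
    by_cases hl : l ∈ Set.Icc (-1 : ℝ) 1
    · exact (hf l hl).trans (le_add_of_nonneg_right (by positivity))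
    · have h1 : 1 ≤ l ^ 2 := by
        by_contra hlt
        push Not at hlt
        exact hl (abs_le.1 (by
          rw [← sq_abs] at hlt
          nlinarith [abs_nonneg l]))
      have h2 : |f l - c / (2 * Real.pi)| ≤ D := by
        refine (abs_sub _ _).trans ?_
        rw [abs_of_nonneg (by positivity : 0 ≤ c / (2 * Real.pi))]
        exact add_le_add_left (hC l) _
      nlinarith
  have hreg : ∀ ε : ℝ, 0 < ε → |(∫ t, K t * Real.exp (-ε * t ^ 2)) - c|
      ≤ η * (2 * Real.pi) + D * (8 * ε) * √(8 * Real.pi ^ 2) := by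
    intro ε hε
    set G : ℝ → ℝ := fun l => √(Real.pi / ε) * Real.exp (-(1 / (4 * ε)) * l ^ 2) with hG
    -- A wider Gaussian replaces the explicit second moment: u ≤ exp u with u = l²/(8ε) gives l²G ≤
    -- 8εG2, and the mass √(8π²) of `G2` does not depend on ε.
    set G2 : ℝ → ℝ := fun l => √(Real.pi / ε) * Real.exp (-(1 / (8 * ε)) * l ^ 2) with hG2
    have hGi : Integrable G := (integrable_exp_neg_mul_sq (by positivity)).const_mul _
    have hG2i : Integrable G2 := (integrable_exp_neg_mul_sq (by positivity)).const_mul _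
    have hGint : ∫ l, G l = 2 * Real.pi := integral_gaussian_kernel hε
    have hG2int : ∫ l, G2 l = √(8 * Real.pi ^ 2) := by
      rw [hG2, integral_const_mul, integral_gaussian, ← Real.sqrt_mul (by positivity)]
      congr 1
      field_simp
    have hGb : ∀ l, l ^ 2 * G l ≤ 8 * ε * G2 l := by
      intro l
      have hx := Real.add_one_le_exp ((1 / (8 * ε)) * l ^ 2)
      have hexp : Real.exp (-(1 / (8 * ε)) * l ^ 2)
          = Real.exp ((1 / (8 * ε)) * l ^ 2) * Real.exp (-(1 / (4 * ε)) * l ^ 2) := by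
        rw [← Real.exp_add]
        congr 1
        field_simp
        ring
      simp only [hG, hG2]
      rw [hexp]
      have hl : l ^ 2 = 8 * ε * ((1 / (8 * ε)) * l ^ 2) := by field_simp
      calc l ^ 2 * (√(Real.pi / ε) * Real.exp (-(1 / (4 * ε)) * l ^ 2))
          = (8 * ε * √(Real.pi / ε) * Real.exp (-(1 / (4 * ε)) * l ^ 2))
            * ((1 / (8 * ε)) * l ^ 2) := by
            nth_rewrite 1 [hl]; ring
        _ ≤ (8 * ε * √(Real.pi / ε) * Real.exp (-(1 / (4 * ε)) * l ^ 2))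
            * Real.exp ((1 / (8 * ε)) * l ^ 2) := by
            gcongr
            linarith
        _ = _ := by ring
    have hfG : Integrable fun l => f l * G l :=
      hGi.bdd_mul h.integrable.aestronglyMeasurable (Eventually.of_forall hC)
    rw [h.integral_mul_gaussian hε]
    have heq : (∫ l, f l * G l) - c = ∫ l, (f l - c / (2 * Real.pi)) * G l := by
      simp only [sub_mul]
      rw [integral_sub hfG (hGi.const_mul _), integral_const_mul, hGint]
      field_simp
    have hrhs : η * (2 * Real.pi) + D * (8 * ε) * √(8 * Real.pi ^ 2)
        = ∫ l, (η * G l + D * (8 * ε) * G2 l) := by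
      rw [integral_add (hGi.const_mul _) (hG2i.const_mul _), ← hGint, ← hG2int, ← integral_const_mul,
        ← integral_const_mul]
    rw [heq, hrhs]
    rw [← Real.norm_eq_abs]
    refine norm_integral_le_of_norm_le ((hGi.const_mul η).add (hG2i.const_mul (D * (8 * ε))))
      (Eventually.of_forall fun l => ?_)
    have hG0 : 0 ≤ G l := by positivity
    rw [norm_mul, Real.norm_of_nonneg hG0, Real.norm_eq_abs]
    have h1 := mul_le_mul_of_nonneg_right (hpt l) hG0
    have h2 := mul_le_mul_of_nonneg_left (hGb l) hD0
    linarith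
  -- Integrability of K provides the domination that removes the damping.
  have hlim : Tendsto (fun ε : ℝ => |(∫ t, K t * Real.exp (-ε * t ^ 2)) - c|) (𝓝[>] 0)
      (𝓝 |(∫ t, K t) - c|) := by
    refine (Tendsto.sub_const ?_ c).abs
    refine tendsto_integral_filter_of_dominated_convergence (fun l => ‖K l‖) ?_ ?_ hK.norm ?_
    · exact Eventually.of_forall fun ε =>
        hK.aestronglyMeasurable.mul (Continuous.aestronglyMeasurable (by fun_prop))
    · filter_upwards [self_mem_nhdsWithin] with ε hε
      refine Eventually.of_forall fun l => ?_
      rw [norm_mul]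
      refine mul_le_of_le_one_right (norm_nonneg _) ?_
      rw [Real.norm_of_nonneg (Real.exp_pos _).le, Real.exp_le_one_iff]
      have : (0 : ℝ) < ε := hε
      nlinarith [sq_nonneg l]
    · refine Eventually.of_forall fun l => ?_
      have : Tendsto (fun ε : ℝ => K l * Real.exp (-ε * l ^ 2)) (𝓝 0)
          (𝓝 (K l * Real.exp (-0 * l ^ 2))) :=
        Continuous.tendsto (by fun_prop) 0
      simp only [neg_zero, zero_mul, Real.exp_zero, mul_one] at this
      exact this.mono_left nhdsWithin_le_nhds
  have hlim2 : Tendsto (fun ε : ℝ => η * (2 * Real.pi) + D * (8 * ε) * √(8 * Real.pi ^ 2))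
      (𝓝[>] 0) (𝓝 (2 * Real.pi * η)) := by
    have : Tendsto (fun ε : ℝ => η * (2 * Real.pi) + D * (8 * ε) * √(8 * Real.pi ^ 2))
      (𝓝 0) (𝓝 (η * (2 * Real.pi) + D * (8 * 0) * √(8 * Real.pi ^ 2))) :=
      Continuous.tendsto (by fun_prop) 0
    rw [show η * (2 * Real.pi) + D * (8 * 0) * √(8 * Real.pi ^ 2) = 2 * Real.pi * η by ring] at this
    exact this.mono_left nhdsWithin_le_nhds
  exact le_of_tendsto_of_tendsto hlim hlim2
    (by filter_upwards [self_mem_nhdsWithin] with ε hε using hreg ε hε)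

lemma tendsto_integral_corr {f K : ℝ → ℝ → ℝ} {C c : ℝ} (hc : 0 < c)
    (h : ∀ Δ, 0 < Δ → IsSpectralDensity (f Δ) (K Δ)) (hK : ∀ Δ, 0 < Δ → Integrable (K Δ))
    (hC : ∀ Δ, 0 < Δ → ∀ l, |f Δ l| ≤ C)
    (hf : TendstoUniformlyOn f (fun _ => c / (2 * Real.pi)) atTop (Set.Icc (-1) 1)) :
    Tendsto (fun Δ => ∫ t, K Δ t) atTop (𝓝 c) := by
  rw [Metric.tendsto_nhds]
  intro ε hε
  have hpi := Real.pi_pos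
  have hη : 0 < ε / (4 * Real.pi) := by positivity
  filter_upwards [Metric.tendstoUniformlyOn_iff.1 hf _ hη, eventually_gt_atTop 0] with Δ h1 hΔ
  rw [Real.dist_eq]
  refine ((h Δ hΔ).abs_integral_sub_le (hK Δ hΔ) hc.le hη.le (hC Δ hΔ) fun l hl => ?_).trans_lt ?_
  · have := h1 l hl
    rw [dist_comm, Real.dist_eq] at this
    exact this.le
  · rw [show 2 * Real.pi * (ε / (4 * Real.pi)) = ε / 2 by field_simp; ring]
    exact half_lt_self hε

lemma sq_integral_mul_le {X : Type*} [MeasurableSpace X] {μ : Measure X} {u v : X → ℝ}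
    (hu : MemLp u 2 μ) (hv : MemLp v 2 μ) :
    (∫ t, u t * v t ∂μ) ^ 2 ≤ (∫ t, u t ^ 2 ∂μ) * ∫ t, v t ^ 2 ∂μ := by
  have key : ∀ {a b : X → ℝ} (ha : MemLp a 2 μ) (hb : MemLp b 2 μ),
      inner ℝ (ha.toLp a) (hb.toLp b) = ∫ t, a t * b t ∂μ := by
    intro a b ha hb
    rw [L2.inner_def]
    refine integral_congr_ae ?_
    filter_upwards [ha.coeFn_toLp, hb.coeFn_toLp] with t h1 h2
    rw [h1, h2, RCLike.inner_apply, conj_trivial, mul_comm]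
  have := real_inner_mul_inner_self_le (hu.toLp u) (hv.toLp v)
  rw [key, key, key] at this
  simpa only [sq] using this

lemma LipClass.continuous {α : ℝ} (hα : 0 < α) {H : ℝ → ℝ} (h : LipClass α H) :
    Continuous H := by
  obtain ⟨δ, hδ, M, hM, hH⟩ := h
  refine continuous_iff_continuousAt.2 fun s => ?_
  rw [ContinuousAt, tendsto_iff_norm_sub_tendsto_zero]
  have hlim : Tendsto (fun t : ℝ => M * |t - s| ^ α) (𝓝 s) (𝓝 0) := by
    have hc : Continuous fun t : ℝ => M * |t - s| ^ α :=
      continuous_const.mul (Continuous.rpow_const (by fun_prop) fun _ => Or.inr hα.le)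
    have := hc.tendsto s
    simpa [Real.zero_rpow hα.ne'] using this
  refine squeeze_zero' (Eventually.of_forall fun _ => norm_nonneg _) ?_ hlim
  filter_upwards [Metric.ball_mem_nhds s hδ] with t ht
  rw [Metric.mem_ball, Real.dist_eq] at ht
  exact hH t s ht

/-- The balance conditions control right-hand tails only; evenness of the correlation function
supplies the left-hand ones. -/
lemma integral_compl_Ioc_of_even {k : ℝ → ℝ} (hk : ∀ t, k (-t) = k t) (hki : Integrable k) {δ : ℝ}
    (hδ : 0 < δ) : ∫ t in (Set.Ioc (-δ) δ)ᶜ, k t = 2 * ∫ t in Set.Ioi δ, k t := by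
  have hset : (Set.Ioc (-δ) δ)ᶜ = Set.Iic (-δ) ∪ Set.Ioi δ := by
    ext t
    simp only [Set.mem_compl_iff, Set.mem_Ioc, Set.mem_union, Set.mem_Iic, Set.mem_Ioi, not_and_or,
      not_lt, not_le]
  have hdisj : Disjoint (Set.Iic (-δ)) (Set.Ioi δ) := by
    rw [Set.disjoint_left]
    intro t h1 h2
    simp only [Set.mem_Iic, Set.mem_Ioi] at h1 h2
    linarith
  rw [hset, setIntegral_union hdisj measurableSet_Ioi hki.integrableOn hki.integrableOn]
  have := integral_comp_neg_Iic (-δ) k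
  simp only [hk, neg_neg] at this
  rw [this]
  ring

/-- The bias of the correlogram vanishes in the limit. -/
lemma tendsto_integral_mul_corr {f K : ℝ → ℝ → ℝ} {H : ℝ → ℝ} {c α : ℝ} (hα : 0 < α)
    (h : ∀ Δ, 0 < Δ → IsSpectralDensity (f Δ) (K Δ)) (hK : ∀ Δ, 0 < Δ → Integrable (K Δ))
    (hlim : Tendsto (fun Δ => ∫ t, K Δ t) atTop (𝓝 c))
    (hH : LipClass α H) (hH2 : MemLp H 2 volume)
    (hK_a : ∀ δ : ℝ, 0 < δ → Tendsto (fun Δ => ∫ t in Set.Ioi δ, K Δ t) atTop (𝓝 0))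
    (hK_b : ∀ δ : ℝ, 0 < δ → Tendsto (fun Δ => ∫ t in Set.Ioi δ, (K Δ t) ^ 2) atTop (𝓝 0))
    (hK_c : ∃ δ : ℝ, 0 < δ ∧
      Tendsto (fun Δ => ∫ t in (-δ)..δ, |K Δ t| * |t| ^ α) atTop (𝓝 0)) (τ : ℝ) :
    Tendsto (fun Δ => ∫ s, H s * K Δ (τ - s)) atTop (𝓝 (c * H τ)) := by
  have hHc := hH.continuous hα
  obtain ⟨δ₁, hδ₁, hK_c⟩ := hK_c
  obtain ⟨δ₂, hδ₂, M, hM, hHL⟩ := hH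
  -- The window must lie inside that of the third balance condition. Halving δ₂ keeps |s| ≤ δ
  -- strictly inside the Lipschitz range.
  set δ := min δ₁ (δ₂ / 2) with hδ_def
  have hδ : 0 < δ := lt_min hδ₁ (by positivity)
  have hδδ₁ : δ ≤ δ₁ := min_le_left _ _
  have hδδ₂ : δ < δ₂ := (min_le_right _ _).trans_lt (half_lt_self hδ₂)
  set S := Set.Ioc (-δ) δ with hS
  have hSm : MeasurableSet S := measurableSet_Ioc
  have hHτ : MemLp (fun s => H (τ - s)) 2 volume :=
    hH2.comp_measurePreserving (Measure.measurePreserving_sub_left volume τ)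
  -- The integral of H(τ-s)K(s) equals T1 + T2 - H(τ)·T3 + H(τ)∫K. `T1` is controlled by the
  -- Lipschitz bound and the weighted balance condition, `T2` by Cauchy–Schwarz and the tail of K²,
  -- and `T3` by the tail of K.
  set T1 : ℝ → ℝ := fun Δ => ∫ s in S, (H (τ - s) - H τ) * K Δ s with hT1
  set T2 : ℝ → ℝ := fun Δ => ∫ s in Sᶜ, H (τ - s) * K Δ s with hT2
  set T3 : ℝ → ℝ := fun Δ => ∫ s in Sᶜ, K Δ s with hT3
  have hT1lim : Tendsto T1 atTop (𝓝 0) := by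
    have hM0 : Tendsto (fun Δ => M * ∫ t in (-δ₁)..δ₁, |K Δ t| * |t| ^ α) atTop (𝓝 0) := by
      simpa using hK_c.const_mul M
    refine squeeze_zero_norm' ?_ hM0
    filter_upwards [eventually_gt_atTop 0] with Δ hΔ
    have hKc := (h Δ hΔ).continuous
    have hcont : Continuous fun t => |K Δ t| * |t| ^ α :=
      hKc.abs.mul (continuous_abs.rpow_const fun _ => Or.inr hα.le)
    rw [intervalIntegral.integral_of_le (by linarith), ← integral_const_mul]
    calc ‖T1 Δ‖ ≤ ∫ t in S, M * (|K Δ t| * |t| ^ α) := by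
          refine norm_integral_le_of_norm_le (hcont.integrableOn_Ioc.const_mul M) ?_
          filter_upwards [ae_restrict_mem hSm] with s hs
          have hs' : |s| < δ₂ := (abs_le.2 ⟨hs.1.le, hs.2⟩).trans_lt hδδ₂
          have := hHL (τ - s) τ (by simpa using hs')
          rw [show τ - s - τ = -s by ring, abs_neg] at this
          rw [norm_mul, Real.norm_eq_abs, Real.norm_eq_abs]
          have := mul_le_mul_of_nonneg_right this (abs_nonneg (K Δ s))
          linarith
      _ ≤ _ := by
          refine setIntegral_mono_set (hcont.integrableOn_Ioc.const_mul M) ?_ ?_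
          · exact Eventually.of_forall fun t => by positivity
          · exact (Set.Ioc_subset_Ioc (by linarith) hδδ₁).eventuallyLE
  have hT2lim : Tendsto T2 atTop (𝓝 0) := by
    have hlim0 : Tendsto (fun Δ => √((∫ s, H (τ - s) ^ 2) *
        (2 * ∫ t in Set.Ioi δ, (K Δ t) ^ 2))) atTop (𝓝 0) := by
      have := (((hK_b δ hδ).const_mul 2).const_mul (∫ s, H (τ - s) ^ 2)).sqrt
      simpa using this
    refine squeeze_zero_norm' ?_ hlim0
    filter_upwards [eventually_gt_atTop 0] with Δ hΔ
    have hK2 := (h Δ hΔ).memLp_two (hK Δ hΔ)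
    rw [Real.norm_eq_abs]
    refine Real.abs_le_sqrt ?_
    refine (sq_integral_mul_le (hHτ.restrict _) (hK2.restrict _)).trans ?_
    rw [← integral_compl_Ioc_of_even (k := fun t => K Δ t ^ 2)
      (fun t => by simp only [(h Δ hΔ).even]) hK2.integrable_sq hδ]
    refine mul_le_mul_of_nonneg_right ?_ (integral_nonneg fun _ => sq_nonneg _)
    exact setIntegral_le_integral hHτ.integrable_sq (Eventually.of_forall fun _ => sq_nonneg _)
  have hT3lim : Tendsto T3 atTop (𝓝 0) := by
    have h0 : Tendsto (fun Δ => 2 * ∫ t in Set.Ioi δ, K Δ t) atTop (𝓝 0) := by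
      simpa using (hK_a δ hδ).const_mul 2
    refine h0.congr' ?_
    filter_upwards [eventually_gt_atTop 0] with Δ hΔ
    exact (integral_compl_Ioc_of_even (h Δ hΔ).even (hK Δ hΔ) hδ).symm
  have hsum : Tendsto (fun Δ => T1 Δ + T2 Δ - H τ * T3 Δ + H τ * ∫ t, K Δ t) atTop
      (𝓝 (0 + 0 - H τ * 0 + H τ * c)) :=
    ((hT1lim.add hT2lim).sub (hT3lim.const_mul _)).add (hlim.const_mul _)
  rw [show 0 + 0 - H τ * 0 + H τ * c = c * H τ by ring] at hsum
  refine hsum.congr' ?_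
  filter_upwards [eventually_gt_atTop 0] with Δ hΔ
  have hK1 := hK Δ hΔ
  have hK2 := (h Δ hΔ).memLp_two hK1
  have hHK : Integrable fun s => H (τ - s) * K Δ s := hHτ.integrable_mul hK2
  have e1 : T1 Δ = (∫ s in S, H (τ - s) * K Δ s) - H τ * ∫ s in S, K Δ s := by
    rw [hT1, ← integral_const_mul, ← integral_sub hHK.integrableOn (hK1.const_mul _).integrableOn]
    simp only [sub_mul]
  have e2 := integral_add_compl hSm hHK
  have e3 := integral_add_compl hSm hK1
  have e4 : ∫ s, H s * K Δ (τ - s) = ∫ s, H (τ - s) * K Δ s := by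
    rw [← integral_sub_left_eq_self _ volume τ]
    simp only [sub_sub_cancel]
  rw [e4, e1, ← e2, ← e3]
  ring

end Kernel

/-! ### Gaussian Hilbert spaces and products of their elements -/

section Gaussian

open RealInnerProductSpace

/-- The moment generating function is exp(vt²/2), and differentiating p(t)exp(vt²/2) replaces p by
p' + vtp. Four such steps from p = 1 leave 3v² at t = 0. -/
lemma integral_pow_four_gaussianReal (v : NNReal) :
    ∫ x, x ^ 4 ∂gaussianReal 0 v = 3 * (v : ℝ) ^ 2 := by
  have hstep : ∀ {p p' : ℝ → ℝ}, (∀ t, HasDerivAt p (p' t) t) →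
      deriv (fun t => p t * Real.exp (v * t ^ 2 / 2))
        = fun t => (p' t + v * t * p t) * Real.exp (v * t ^ 2 / 2) := by
    intro p p' hp
    ext t
    have h1 : HasDerivAt (fun t : ℝ => (v : ℝ) * t ^ 2 / 2) (v * t) t := by
      refine (((hasDerivAt_pow 2 t).const_mul (v : ℝ)).div_const 2).congr_deriv ?_
      push_cast
      ring
    rw [((hp t).fun_mul h1.exp).deriv]
    ring
  have h := iteratedDeriv_mgf_zero (X := fun x : ℝ => x) (μ := gaussianReal 0 v) (by simp) 4
  rw [mgf_fun_id_gaussianReal] at h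
  have e : (fun t : ℝ => Real.exp (0 * t + v * t ^ 2 / 2))
      = fun t : ℝ => (1 : ℝ) * Real.exp (v * t ^ 2 / 2) := by
    ext t; simp
  -- The polynomials are left in the unsimplified form that `hstep` produces, so that the successive
  -- rewrites match.
  have d0 : ∀ t : ℝ, HasDerivAt (fun _ : ℝ => (1 : ℝ)) 0 t := fun t => hasDerivAt_const t 1
  have d1 : ∀ t : ℝ, HasDerivAt (fun t : ℝ => 0 + (v : ℝ) * t * 1) v t := fun t => by
    simpa using (hasDerivAt_id t).const_mul (v : ℝ)
  have d2 : ∀ t : ℝ, HasDerivAt (fun t : ℝ => (v : ℝ) + v * t * (0 + (v : ℝ) * t * 1))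
      (2 * v ^ 2 * t) t := fun t => by
    have h := ((hasDerivAt_pow 2 t).const_mul ((v : ℝ) ^ 2)).const_add (v : ℝ)
    refine (h.congr_deriv (by push_cast; ring)).congr_of_eventuallyEq
      (Eventually.of_forall fun s => ?_)
    simp only
    ring
  have d3 : ∀ t : ℝ, HasDerivAt (fun t : ℝ => 2 * (v : ℝ) ^ 2 * t
      + v * t * ((v : ℝ) + v * t * (0 + (v : ℝ) * t * 1)))
      (3 * v ^ 2 + 3 * v ^ 3 * t ^ 2) t := fun t => by
    have h := ((hasDerivAt_id' t).const_mul (3 * (v : ℝ) ^ 2)).fun_add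
      ((hasDerivAt_pow 3 t).const_mul ((v : ℝ) ^ 3))
    refine (h.congr_deriv (by push_cast; ring)).congr_of_eventuallyEq
      (Eventually.of_forall fun s => ?_)
    simp only
    ring
  rw [e, iteratedDeriv_succ, iteratedDeriv_succ, iteratedDeriv_succ, iteratedDeriv_one,
    hstep d0, hstep d1, hstep d2, hstep d3] at h
  simp only [Pi.pow_apply] at h
  rw [← h]
  simp

variable {P : Measure Ω}

lemma integral_coe_mul_coe (v w : Lp ℝ 2 P) : ∫ ω, v ω * w ω ∂P = ⟪v, w⟫ := by
  rw [L2.inner_def]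
  refine integral_congr_ae (Eventually.of_forall fun ω => ?_)
  simp only [RCLike.inner_apply, conj_trivial]
  ring

lemma integral_sq_coe (v : Lp ℝ 2 P) : ∫ ω, v ω ^ 2 ∂P = ‖v‖ ^ 2 := by
  simp only [sq]
  rw [integral_coe_mul_coe, real_inner_self_eq_norm_mul_norm]

/-- `v` is a random variable with characteristic function at `1` that of `N(0, ‖v‖²)`. -/
def GaussianChar (v : Lp ℝ 2 P) : Prop :=
  ∫ ω, Complex.exp (Complex.I * (v ω : ℂ)) ∂P = Complex.exp (-((‖v‖ : ℂ) ^ 2) / 2)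

lemma gaussianChar_of_hasGaussianLaw {v : Lp ℝ 2 P} (h : HasGaussianLaw v P)
    (h0 : ∫ ω, v ω ∂P = 0) : GaussianChar v := by
  have hm := (Lp.aestronglyMeasurable v).aemeasurable
  have hvar : Var[v; P] = ‖v‖ ^ 2 := by
    rw [variance_of_integral_eq_zero hm h0, integral_sq_coe]
  have h1 := charFun_gaussianReal (μ := ∫ ω, v ω ∂P) (v := Var[v; P].toNNReal) 1
  rw [← h.map_eq_gaussianReal, charFun_apply_real, integral_map hm (by fun_prop), h0, hvar,
    Real.coe_toNNReal _ (by positivity)] at h1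
  rw [GaussianChar]
  convert h1 using 2
  · ext ω; push_cast; ring_nf
  · push_cast; ring

/-- A linear space of random variables in `L₂(P)` all of which are centred Gaussian. -/
def IsGaussianSpace (S : Submodule ℝ (Lp ℝ 2 P)) : Prop :=
  ∀ v ∈ S, P.map v = gaussianReal 0 (‖v‖₊ ^ 2)

lemma IsGaussianSpace.integrable_pow_four {S : Submodule ℝ (Lp ℝ 2 P)}
    (hS : IsGaussianSpace S) {v : Lp ℝ 2 P} (hv : v ∈ S) :
    Integrable (fun ω => v ω ^ 4) P := by
  have hm := (Lp.aestronglyMeasurable v).aemeasurable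
  have h : MemLp id 4 (P.map v) := by
    rw [hS v hv]
    exact memLp_id_gaussianReal' 4 (by norm_num)
  rw [memLp_map_measure_iff (by fun_prop) hm] at h
  have := h.integrable_norm_pow (p := 4) (by norm_num)
  refine this.congr (Eventually.of_forall fun ω => ?_)
  simp only [Function.comp, id]
  rw [Real.norm_eq_abs, Even.pow_abs (by decide)]

lemma IsGaussianSpace.integral_pow_four {S : Submodule ℝ (Lp ℝ 2 P)}
    (hS : IsGaussianSpace S) {v : Lp ℝ 2 P} (hv : v ∈ S) :
    ∫ ω, v ω ^ 4 ∂P = 3 * (‖v‖ ^ 2) ^ 2 := by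
  have hm := (Lp.aestronglyMeasurable v).aemeasurable
  have h := integral_pow_four_gaussianReal (‖v‖₊ ^ 2)
  rw [← hS v hv, integral_map hm (by fun_prop)] at h
  rw [h]
  push_cast
  rfl

lemma gaussianChar_of_mem_span {T : Type*} {Z : T → Ω → ℝ} (hZ : IsGaussianProcess Z P)
    (hZ0 : ∀ t, ∫ ω, Z t ω ∂P = 0) {z : T → Lp ℝ 2 P} (hz : ∀ t, Z t =ᵐ[P] z t) :
    ∀ v ∈ Submodule.span ℝ (Set.range z), GaussianChar v := by
  intro v hv
  obtain ⟨c, rfl⟩ := Finsupp.mem_span_range_iff_exists_finsupp.1 hv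
  have hae : ∀ I : Finset T, (fun ω => ∑ i ∈ I, c i • Z i ω)
      =ᵐ[P] ((∑ i ∈ I, c i • z i : Lp ℝ 2 P) : Ω → ℝ) := by
    classical
    intro I
    induction I using Finset.induction_on with
    | empty =>
      simp only [Finset.sum_empty]
      exact (Lp.coeFn_zero ℝ 2 P).symm
    | insert i I hi ih =>
      simp only [Finset.sum_insert hi]
      filter_upwards [ih, Lp.coeFn_add (c i • z i) (∑ i ∈ I, c i • z i),
        Lp.coeFn_smul (c i) (z i), hz i] with ω h1 h2 h3 h4
      rw [h2, Pi.add_apply, h3, h1, Pi.smul_apply, h4]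
  have hlaw := (hZ.smul c).hasGaussianLaw_fun_sum (I := c.support)
  refine gaussianChar_of_hasGaussianLaw (hlaw.congr (hae c.support)) ?_
  rw [Finsupp.sum, ← integral_congr_ae (hae c.support), integral_finsetSum]
  · refine Finset.sum_eq_zero fun i _ => ?_
    rw [integral_smul, hZ0, smul_zero]
  · exact fun i _ => (hZ.hasGaussianLaw_eval i).integrable.smul (c i)

namespace IsGaussianSpace

variable {S : Submodule ℝ (Lp ℝ 2 P)}

/-- Every linear combination stays in the Gaussian space, so its fourth moment is three times its
squared variance; this is the input to polarisation. -/
lemma integral_signed_pow_four (hS : IsGaussianSpace S) {a b c d : Lp ℝ 2 P} (ha : a ∈ S)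
    (hb : b ∈ S) (hc : c ∈ S) (hd : d ∈ S) (r s t : ℝ) :
    Integrable (fun ω => (a ω + r * b ω + s * c ω + t * d ω) ^ 4) P ∧
    ∫ ω, (a ω + r * b ω + s * c ω + t * d ω) ^ 4 ∂P
      = 3 * (⟪a, a⟫ + r ^ 2 * ⟪b, b⟫ + s ^ 2 * ⟪c, c⟫ + t ^ 2 * ⟪d, d⟫
        + 2 * (r * ⟪a, b⟫ + s * ⟪a, c⟫ + t * ⟪a, d⟫ + r * s * ⟪b, c⟫ + r * t * ⟪b, d⟫
          + s * t * ⟪c, d⟫)) ^ 2 := by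
  have hmem : a + r • b + s • c + t • d ∈ S :=
    S.add_mem (S.add_mem (S.add_mem ha (S.smul_mem _ hb)) (S.smul_mem _ hc)) (S.smul_mem _ hd)
  have hae : (fun ω => (a + r • b + s • c + t • d : Lp ℝ 2 P) ω ^ 4)
      =ᵐ[P] fun ω => (a ω + r * b ω + s * c ω + t * d ω) ^ 4 := by
    filter_upwards [Lp.coeFn_add (a + r • b + s • c) (t • d), Lp.coeFn_add (a + r • b) (s • c),
      Lp.coeFn_add a (r • b), Lp.coeFn_smul r b, Lp.coeFn_smul s c, Lp.coeFn_smul t d]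
      with ω h1 h2 h3 h4 h5 h6
    simp only [h1, h2, h3, h4, h5, h6, Pi.add_apply, Pi.smul_apply, smul_eq_mul]
  refine ⟨(hS.integrable_pow_four hmem).congr hae, ?_⟩
  rw [← integral_congr_ae hae, hS.integral_pow_four hmem]
  congr 2
  rw [← real_inner_self_eq_norm_sq]
  simp only [inner_add_left, inner_add_right, real_inner_smul_left, real_inner_smul_right]
  rw [real_inner_comm a b, real_inner_comm a c, real_inner_comm a d, real_inner_comm b c,
    real_inner_comm b d, real_inner_comm c d]
  ring

/-- The fourth mixed moment of centred jointly Gaussian variables. -/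
lemma integral_mul_mul_mul (hS : IsGaussianSpace S) {a b c d : Lp ℝ 2 P} (ha : a ∈ S)
    (hb : b ∈ S) (hc : c ∈ S) (hd : d ∈ S) :
    Integrable (fun ω => a ω * b ω * (c ω * d ω)) P ∧
    ∫ ω, a ω * b ω * (c ω * d ω) ∂P
      = ⟪a, b⟫ * ⟪c, d⟫ + ⟪a, c⟫ * ⟪b, d⟫ + ⟪a, d⟫ * ⟪b, c⟫ := by
  have key := hS.integral_signed_pow_four ha hb hc hd
  -- Polarisation: summing rst(a + rb + sc + td)⁴ over the eight choices of signs leaves only the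
  -- monomial abcd, with coefficient 8 · 4! = 192.
  have hpt : (fun ω => a ω * b ω * (c ω * d ω)) = fun ω => (1 / 192 : ℝ) *
      ((a ω + 1 * b ω + 1 * c ω + 1 * d ω) ^ 4 - (a ω + 1 * b ω + 1 * c ω + (-1) * d ω) ^ 4
      - (a ω + 1 * b ω + (-1) * c ω + 1 * d ω) ^ 4
      + (a ω + 1 * b ω + (-1) * c ω + (-1) * d ω) ^ 4
      - (a ω + (-1) * b ω + 1 * c ω + 1 * d ω) ^ 4
      + (a ω + (-1) * b ω + 1 * c ω + (-1) * d ω) ^ 4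
      + (a ω + (-1) * b ω + (-1) * c ω + 1 * d ω) ^ 4
      - (a ω + (-1) * b ω + (-1) * c ω + (-1) * d ω) ^ 4) := by
    ext ω; ring
  have add : ∀ {F G : Ω → ℝ} {p q : ℝ}, (Integrable F P ∧ ∫ ω, F ω ∂P = p) →
      (Integrable G P ∧ ∫ ω, G ω ∂P = q) →
      (Integrable (fun ω => F ω + G ω) P ∧ ∫ ω, (F ω + G ω) ∂P = p + q) :=
    fun hF hG => ⟨hF.1.add hG.1, by rw [integral_add hF.1 hG.1, hF.2, hG.2]⟩
  have sub : ∀ {F G : Ω → ℝ} {p q : ℝ}, (Integrable F P ∧ ∫ ω, F ω ∂P = p) →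
      (Integrable G P ∧ ∫ ω, G ω ∂P = q) →
      (Integrable (fun ω => F ω - G ω) P ∧ ∫ ω, (F ω - G ω) ∂P = p - q) :=
    fun hF hG => ⟨hF.1.sub hG.1, by rw [integral_sub hF.1 hG.1, hF.2, hG.2]⟩
  have h := sub (add (add (sub (add (sub (sub (key 1 1 1) (key 1 1 (-1))) (key 1 (-1) 1))
    (key 1 (-1) (-1))) (key (-1) 1 1)) (key (-1) 1 (-1))) (key (-1) (-1) 1)) (key (-1) (-1) (-1))
  rw [hpt]
  refine ⟨h.1.const_mul _, ?_⟩
  rw [integral_const_mul, h.2]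
  ring

lemma memLp_mul (hS : IsGaussianSpace S) {v w : Lp ℝ 2 P} (hv : v ∈ S) (hw : w ∈ S) :
    MemLp (fun ω => v ω * w ω) 2 P := by
  rw [memLp_two_iff_integrable_sq
    ((Lp.aestronglyMeasurable v).fun_mul (Lp.aestronglyMeasurable w))]
  simp only [sq]
  exact (hS.integral_mul_mul_mul hv hw hv hw).1

/-- The product of two elements of a Gaussian space, in `L₂(P)`. -/
def prod (hS : IsGaussianSpace S) (v w : S) : Lp ℝ 2 P :=
  (hS.memLp_mul v.2 w.2).toLp

lemma coeFn_prod (hS : IsGaussianSpace S) (v w : S) :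
    hS.prod v w =ᵐ[P] fun ω => (v : Lp ℝ 2 P) ω * (w : Lp ℝ 2 P) ω :=
  MemLp.coeFn_toLp _

lemma inner_prod (hS : IsGaussianSpace S) (a b c d : S) :
    ⟪hS.prod a b, hS.prod c d⟫ = ⟪a, b⟫ * ⟪c, d⟫ + ⟪a, c⟫ * ⟪b, d⟫ + ⟪a, d⟫ * ⟪b, c⟫ := by
  simp only [Submodule.coe_inner]
  rw [← (hS.integral_mul_mul_mul a.2 b.2 c.2 d.2).2, ← integral_coe_mul_coe]
  refine integral_congr_ae ?_
  filter_upwards [hS.coeFn_prod a b, hS.coeFn_prod c d] with ω h1 h2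
  rw [h1, h2]

lemma norm_prod_sq_le (hS : IsGaussianSpace S) (a b : S) :
    ‖hS.prod a b‖ ^ 2 ≤ 3 * (‖a‖ * ‖b‖) ^ 2 := by
  rw [← real_inner_self_eq_norm_sq, hS.inner_prod, real_inner_self_eq_norm_sq,
    real_inner_self_eq_norm_sq, real_inner_comm a b]
  have := real_inner_le_norm a b
  have h2 := abs_real_inner_le_norm a b
  have h3 : ⟪a, b⟫ ^ 2 ≤ (‖a‖ * ‖b‖) ^ 2 := by
    rw [← sq_abs]
    gcongr
  nlinarith

/-- On a Gaussian space multiplication is a bounded bilinear map into L₂(P), which makes products of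
continuous curves continuous. The constant 2 is a convenient bound for √3. -/
lemma norm_prod_le (hS : IsGaussianSpace S) (a b : S) :
    ‖hS.prod a b‖ ≤ 2 * (‖a‖ * ‖b‖) := by
  refine (le_abs_self _).trans (abs_le_of_sq_le_sq ?_ (by positivity))
  nlinarith [hS.norm_prod_sq_le a b, sq_nonneg (‖a‖ * ‖b‖)]

lemma prod_sub_prod (hS : IsGaussianSpace S) (a b c d : S) :
    hS.prod a b - hS.prod c d = hS.prod (a - c) b + hS.prod c (b - d) := by
  refine Lp.ext ?_
  filter_upwards [hS.coeFn_prod a b, hS.coeFn_prod c d, hS.coeFn_prod (a - c) b,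
    hS.coeFn_prod c (b - d), Lp.coeFn_sub (hS.prod a b) (hS.prod c d),
    Lp.coeFn_add (hS.prod (a - c) b) (hS.prod c (b - d)),
    Lp.coeFn_sub (a : Lp ℝ 2 P) c, Lp.coeFn_sub (b : Lp ℝ 2 P) d] with ω h1 h2 h3 h4 h5 h6 h7 h8
  rw [h5, h6, Pi.sub_apply, Pi.add_apply, h1, h2, h3, h4, Submodule.coe_sub, Submodule.coe_sub,
    h7, h8, Pi.sub_apply, Pi.sub_apply]
  ring

lemma continuous_prod (hS : IsGaussianSpace S) {y x : ℝ → S} (hy : Continuous y)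
    (hx : Continuous x) : Continuous fun t => hS.prod (y t) (x t) := by
  refine continuous_iff_continuousAt.2 fun s => ?_
  rw [ContinuousAt, tendsto_iff_norm_sub_tendsto_zero]
  have hlim : Tendsto (fun t => 2 * (‖y t - y s‖ * ‖x t‖) + 2 * (‖y s‖ * ‖x t - x s‖)) (𝓝 s)
      (𝓝 0) := by
    have hc : Continuous fun t => 2 * (‖y t - y s‖ * ‖x t‖) + 2 * (‖y s‖ * ‖x t - x s‖) := by
      fun_prop
    simpa using hc.tendsto s
  refine squeeze_zero (fun _ => norm_nonneg _) (fun t => ?_) hlim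
  rw [hS.prod_sub_prod]
  exact (norm_add_le _ _).trans (add_le_add (hS.norm_prod_le _ _) (hS.norm_prod_le _ _))

end IsGaussianSpace

variable [IsProbabilityMeasure P]

lemma integral_abs_coe_le (v : Lp ℝ 2 P) : ∫ ω, |v ω| ∂P ≤ ‖v‖ := by
  have h := sq_integral_mul_le (Lp.memLp v).abs (memLp_const (1 : ℝ) (μ := P))
  simp only [sq_abs, Pi.abs_apply, mul_one, integral_sq_coe, one_pow, integral_const,
    probReal_univ, smul_eq_mul] at h
  exact (le_abs_self _).trans (abs_le_of_sq_le_sq h (norm_nonneg _))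

lemma integrable_cexp_coe (v : Lp ℝ 2 P) :
    Integrable (fun ω => Complex.exp (Complex.I * (v ω : ℂ))) P := by
  have hm := (Lp.aestronglyMeasurable v).aemeasurable
  refine Integrable.of_bound (C := 1) (by fun_prop) (Eventually.of_forall fun ω => ?_)
  rw [mul_comm, Complex.norm_exp_ofReal_mul_I]

lemma continuous_integral_cexp_coe :
    Continuous fun v : Lp ℝ 2 P => ∫ ω, Complex.exp (Complex.I * (v ω : ℂ)) ∂P := by
  refine (LipschitzWith.of_dist_le_mul (K := 1) fun v w => ?_).continuous
  rw [NNReal.coe_one, one_mul, dist_eq_norm, dist_eq_norm,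
    ← integral_sub (integrable_cexp_coe v) (integrable_cexp_coe w)]
  refine (norm_integral_le_of_norm_le (g := fun ω => |(v - w : Lp ℝ 2 P) ω|)
    ((Lp.memLp (v - w)).integrable one_le_two).abs ?_).trans (integral_abs_coe_le (v - w))
  filter_upwards [Lp.coeFn_sub v w] with ω hω
  rw [hω, Pi.sub_apply]
  have : Complex.exp (Complex.I * (v ω : ℂ)) - Complex.exp (Complex.I * (w ω : ℂ))
      = Complex.exp ((w ω : ℂ) * Complex.I)
        * (Complex.exp (Complex.I * ((v ω - w ω : ℝ) : ℂ)) - 1) := by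
    rw [mul_sub, mul_one, ← Complex.exp_add]
    push_cast
    ring_nf
  rw [this, norm_mul, Complex.norm_exp_ofReal_mul_I, one_mul]
  exact Real.norm_exp_I_mul_ofReal_sub_one_le

/-- Both sides of the defining identity are continuous in L₂(P), so it survives limits. -/
lemma gaussianChar_topologicalClosure {S : Submodule ℝ (Lp ℝ 2 P)}
    (hS : ∀ v ∈ S, GaussianChar v) : ∀ v ∈ S.topologicalClosure, GaussianChar v := by
  have hclosed : IsClosed {v : Lp ℝ 2 P | GaussianChar v} :=
    isClosed_eq continuous_integral_cexp_coe (by fun_prop)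
  intro v hv
  exact closure_minimal hS hclosed hv

/-- The value of the characteristic function at 1 suffices, because a subspace contains tv along
with v and thus yields its value at every t. -/
lemma isGaussianSpace_of_gaussianChar {S : Submodule ℝ (Lp ℝ 2 P)}
    (hS : ∀ v ∈ S, GaussianChar v) : IsGaussianSpace S := by
  intro v hv
  have hm := (Lp.aestronglyMeasurable v).aemeasurable
  have : IsProbabilityMeasure (P.map v) := Measure.isProbabilityMeasure_map hm
  refine Measure.ext_of_charFun (funext fun t => ?_)
  have h := hS _ (S.smul_mem t hv)
  rw [charFun_gaussianReal, charFun_apply_real, integral_map hm (by fun_prop)]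
  rw [GaussianChar] at h
  refine Eq.trans ?_ (h.trans ?_)
  · refine integral_congr_ae ?_
    filter_upwards [Lp.coeFn_smul t v] with ω hω
    rw [hω, Pi.smul_apply, smul_eq_mul]
    push_cast
    ring_nf
  · congr 1
    rw [norm_smul]
    have : ((‖t‖ : ℝ) : ℂ) ^ 2 = (t : ℂ) ^ 2 := by
      rw [← Complex.ofReal_pow, Real.norm_eq_abs, sq_abs, Complex.ofReal_pow]
    push_cast
    rw [mul_pow, this]
    ring

lemma isGaussianSpace_closure_span {T : Type*} {Z : T → Ω → ℝ} (hZ : IsGaussianProcess Z P)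
    (hZ0 : ∀ t, ∫ ω, Z t ω ∂P = 0) {z : T → Lp ℝ 2 P} (hz : ∀ t, Z t =ᵐ[P] z t) :
    IsGaussianSpace (Submodule.span ℝ (Set.range z)).topologicalClosure :=
  isGaussianSpace_of_gaussianChar
    (gaussianChar_topologicalClosure (gaussianChar_of_mem_span hZ hZ0 hz))

/-- The constant random variable `1` in `L₂(P)`. -/
def oneLp (P : Measure Ω) [IsProbabilityMeasure P] : Lp ℝ 2 P :=
  (memLp_const (1 : ℝ)).toLp

lemma coeFn_oneLp : oneLp P =ᵐ[P] fun _ => (1 : ℝ) := MemLp.coeFn_toLp _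

lemma inner_oneLp_oneLp : ⟪oneLp P, oneLp P⟫ = (1 : ℝ) := by
  rw [← integral_coe_mul_coe]
  have : (fun ω => oneLp P ω * oneLp P ω) =ᵐ[P] fun _ => (1 : ℝ) := by
    filter_upwards [coeFn_oneLp (P := P)] with ω hω
    rw [hω, mul_one]
  rw [integral_congr_ae this]
  simp

/-- Pairing with the constant 1 takes expectations, so centring a product means subtracting a
multiple of `oneLp`. -/
lemma IsGaussianSpace.inner_prod_oneLp {S : Submodule ℝ (Lp ℝ 2 P)} (hS : IsGaussianSpace S)
    (a b : S) : ⟪hS.prod a b, oneLp P⟫ = ⟪a, b⟫ := by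
  rw [← integral_coe_mul_coe, Submodule.coe_inner, ← integral_coe_mul_coe]
  refine integral_congr_ae ?_
  filter_upwards [coeFn_oneLp (P := P), hS.coeFn_prod a b] with ω h1 h2
  rw [h1, h2, mul_one]

end Gaussian

/-! ### The response in a Hilbert space -/

section Response

open RealInnerProductSpace

variable {E : Type*} [NormedAddCommGroup E] [InnerProductSpace ℝ E]

/-- The squared increment is 2(K(0) - K(t - s)). -/
lemma continuous_of_inner_eq {x : ℝ → E} {K : ℝ → ℝ} (hK : Continuous K)
    (hx : ∀ s t, ⟪x s, x t⟫ = K (s - t)) : Continuous x := by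
  refine continuous_iff_continuousAt.2 fun s => ?_
  rw [ContinuousAt, tendsto_iff_norm_sub_tendsto_zero]
  have hlim : Tendsto (fun t => √(K 0 - 2 * K (t - s) + K 0)) (𝓝 s) (𝓝 0) := by
    have hc : Continuous fun t => √(K 0 - 2 * K (t - s) + K 0) := by fun_prop
    have := hc.tendsto s
    simp only [sub_self] at this
    rwa [show K 0 - 2 * K 0 + K 0 = 0 by ring, Real.sqrt_zero] at this
  refine hlim.congr fun t => ?_
  rw [← Real.sqrt_sq (norm_nonneg (x t - x s)), norm_sub_sq_real, ← real_inner_self_eq_norm_sq,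
    ← real_inner_self_eq_norm_sq, hx, hx, hx, sub_self, sub_self]

variable {x : ℝ → E} {f H : ℝ → ℝ} {C : ℝ} [CompleteSpace E]

namespace HasBoundedSpectrum

/-- Writing the bound through a primitive of H² removes the ordering of the endpoints and reduces
the Cauchy property of the truncated responses to that of a convergent scalar function. -/
lemma norm_integral_smul_sq_le_abs (h : HasBoundedSpectrum x f C) (hH : Continuous H) (a b : ℝ) :
    ‖∫ s in a..b, H s • x s‖ ^ 2
      ≤ 2 * Real.pi * C * |(∫ s in (0 : ℝ)..b, H s ^ 2) - ∫ s in (0 : ℝ)..a, H s ^ 2| := by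
  have hint : ∀ a b, IntervalIntegrable (fun s => H s ^ 2) volume a b := fun a b =>
    Continuous.intervalIntegrable (by fun_prop) a b
  have hB : 0 ≤ 2 * Real.pi * C := mul_nonneg (by positivity) h.bound_nonneg
  rw [intervalIntegral.integral_interval_sub_left (hint _ _) (hint _ _)]
  rcases le_total a b with hab | hab
  · refine (h.norm_sq_integral_smul_le hH hab).trans ?_
    exact mul_le_mul_of_nonneg_left (le_abs_self _) hB
  · rw [intervalIntegral.integral_symm b a, intervalIntegral.integral_symm b a, norm_neg, abs_neg]
    refine (h.norm_sq_integral_smul_le hH hab).trans ?_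
    exact mul_le_mul_of_nonneg_left (le_abs_self _) hB

/-- Reflection and translation of the time argument preserve the spectrum, so the estimate is the
same for all t. This uniformity makes the limit continuous in t. -/
lemma uniformCauchySeqOn_integral (h : HasBoundedSpectrum x f C) (hH : Continuous H)
    (hH2 : MemLp H 2 volume) :
    UniformCauchySeqOn (fun (p : ℝ × ℝ) (t : ℝ) => ∫ s in p.1..p.2, H s • x (t - s))
      (atBot ×ˢ atTop) Set.univ := by
  have hB : 0 ≤ 2 * Real.pi * C := mul_nonneg (by positivity) h.bound_nonneg
  have hH2i : Integrable fun s => H s ^ 2 := hH2.integrable_sq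
  have htop : Cauchy (map (fun b => ∫ s in (0 : ℝ)..b, H s ^ 2) atTop) :=
    (intervalIntegral_tendsto_integral_Ioi 0 hH2i.integrableOn tendsto_id).cauchy_map
  have hbot : Cauchy (map (fun a => ∫ s in (0 : ℝ)..a, H s ^ 2) atBot) := by
    have := (intervalIntegral_tendsto_integral_Iic 0 hH2i.integrableOn tendsto_id).neg
    simp only [← intervalIntegral.integral_symm] at this
    exact this.cauchy_map
  rw [cauchy_map_iff'] at htop hbot
  intro V hV
  obtain ⟨ε, hε, hεV⟩ := Metric.mem_uniformity_dist.1 hV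
  -- Each of the two end pieces must have norm below ε/2; the 1 in the denominator covers C = 0.
  set η : ℝ := (ε / 2) ^ 2 / (2 * Real.pi * C + 1) with hη
  have hη0 : 0 < η := by positivity
  have hηb : 2 * Real.pi * C * η < (ε / 2) ^ 2 := by
    rw [hη, mul_div_assoc', div_lt_iff₀ (by linarith)]
    nlinarith [sq_pos_of_pos (half_pos hε)]
  have e1 := hbot (Metric.dist_mem_uniformity hη0)
  have e2 := htop (Metric.dist_mem_uniformity hη0)
  have e3 : ∀ᶠ q : (ℝ × ℝ) × (ℝ × ℝ) in (atBot ×ˢ atTop) ×ˢ (atBot ×ˢ atTop),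
      dist (∫ s in (0 : ℝ)..q.1.1, H s ^ 2) (∫ s in (0 : ℝ)..q.2.1, H s ^ 2) < η :=
    (tendsto_fst.comp tendsto_fst).prodMk (tendsto_fst.comp tendsto_snd) |>.eventually e1
  have e4 : ∀ᶠ q : (ℝ × ℝ) × (ℝ × ℝ) in (atBot ×ˢ atTop) ×ˢ (atBot ×ˢ atTop),
      dist (∫ s in (0 : ℝ)..q.1.2, H s ^ 2) (∫ s in (0 : ℝ)..q.2.2, H s ^ 2) < η :=
    (tendsto_snd.comp tendsto_fst).prodMk (tendsto_snd.comp tendsto_snd) |>.eventually e2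
  filter_upwards [e3, e4] with q h3 h4 t _
  refine hεV ?_
  have hx := h.cont
  have hint : ∀ a b, IntervalIntegrable (fun s => H s • x (t - s)) volume a b := fun a b =>
    Continuous.intervalIntegrable (by fun_prop) a b
  rw [dist_eq_norm, intervalIntegral.integral_interval_sub_interval_comm (hint _ _) (hint _ _)
    (hint _ _)]
  have hpiece : ∀ a b, dist (∫ s in (0 : ℝ)..a, H s ^ 2) (∫ s in (0 : ℝ)..b, H s ^ 2) < η →
      ‖∫ s in a..b, H s • x (t - s)‖ < ε / 2 := by
    intro a b hab
    have hle := (h.comp_sub_left t).norm_integral_smul_sq_le_abs hH a b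
    rw [dist_comm, Real.dist_eq] at hab
    refine lt_of_pow_lt_pow_left₀ 2 (by positivity) ((hle.trans ?_).trans_lt hηb)
    exact mul_le_mul_of_nonneg_left hab.le hB
  refine (norm_sub_le _ _).trans_lt ?_
  linarith [hpiece _ _ h3, hpiece _ _ h4]

/-- The response `∫ H(s) x(t - s) ds` exists as a continuous curve in the Hilbert space. -/
lemma exists_response (h : HasBoundedSpectrum x f C) (hH : Continuous H)
    (hH2 : MemLp H 2 volume) :
    ∃ z : ℝ → E, Continuous z ∧ ∀ t, Tendsto (fun p : ℝ × ℝ => ∫ s in p.1..p.2, H s • x (t - s))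
      (atBot ×ˢ atTop) (𝓝 (z t)) := by
  have hu := h.uniformCauchySeqOn_integral hH hH2
  have hex : ∀ t, ∃ z, Tendsto (fun p : ℝ × ℝ => ∫ s in p.1..p.2, H s • x (t - s))
      (atBot ×ˢ atTop) (𝓝 z) := fun t =>
    cauchy_map_iff_exists_tendsto.1 (hu.cauchy_map (Set.mem_univ t))
  choose z hz using hex
  refine ⟨z, ?_, hz⟩
  have hunif := tendstoUniformlyOn_univ.1 (hu.tendstoUniformlyOn_of_tendsto fun t _ => hz t)
  refine hunif.continuous (Frequently.of_forall fun p => ?_)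
  have hx := h.cont
  exact intervalIntegral.continuous_parametric_intervalIntegral_of_continuous' (by fun_prop) _ _

lemma norm_response_sq_le (h : HasBoundedSpectrum x f C) (hH : Continuous H)
    (hH2 : MemLp H 2 volume) {t : ℝ} {z : E}
    (hz : Tendsto (fun p : ℝ × ℝ => ∫ s in p.1..p.2, H s • x (t - s)) (atBot ×ˢ atTop) (𝓝 z)) :
    ‖z‖ ^ 2 ≤ 2 * Real.pi * C * ∫ s, H s ^ 2 := by
  refine le_of_tendsto (hz.norm.pow 2) ?_
  filter_upwards [eventually_atBot_prod_atTop_le] with p hp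
  refine ((h.comp_sub_left t).norm_sq_integral_smul_le hH hp).trans ?_
  refine mul_le_mul_of_nonneg_left ?_ (mul_nonneg (by positivity) h.bound_nonneg)
  rw [intervalIntegral.integral_of_le hp]
  exact setIntegral_le_integral hH2.integrable_sq (Eventually.of_forall fun _ => sq_nonneg _)

lemma inner_response (h : HasBoundedSpectrum x f C) (hH : Continuous H) {t : ℝ} {z v : E}
    (hz : Tendsto (fun p : ℝ × ℝ => ∫ s in p.1..p.2, H s • x (t - s)) (atBot ×ˢ atTop) (𝓝 z))
    {k : ℝ → ℝ} (hk : ∀ s, ⟪v, x (t - s)⟫ = k s) (hHk : Integrable fun s => H s * k s) :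
    ⟪v, z⟫ = ∫ s, H s * k s := by
  have h1 : Tendsto (fun p : ℝ × ℝ => ⟪v, ∫ s in p.1..p.2, H s • x (t - s)⟫) (atBot ×ˢ atTop)
      (𝓝 ⟪v, z⟫) := tendsto_const_nhds.inner hz
  have h2 : Tendsto (fun p : ℝ × ℝ => ∫ s in p.1..p.2, H s * k s) (atBot ×ˢ atTop)
      (𝓝 (∫ s, H s * k s)) := intervalIntegral_tendsto_integral hHk tendsto_fst tendsto_snd
  refine tendsto_nhds_unique (h1.congr fun p => ?_) h2
  have hx := h.cont
  have := (innerSL ℝ v).intervalIntegral_comp_comm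
    (Continuous.intervalIntegrable (μ := volume) (a := p.1) (b := p.2)
      (u := fun s => H s • x (t - s)) (by fun_prop))
  simp only [innerSL_apply_apply, real_inner_smul_right, hk] at this
  exact this.symm

end HasBoundedSpectrum

lemma integrable_prod_restrict_Ioc {k : ℝ × ℝ → ℝ} (hk : Continuous k) (a b : ℝ) :
    Integrable k ((volume.restrict (Set.Ioc a b)).prod (volume.restrict (Set.Ioc a b))) := by
  rw [Measure.prod_restrict]
  have : IntegrableOn k (Set.Icc a b ×ˢ Set.Icc a b) (volume.prod volume) :=
    hk.continuousOn.integrableOn_compact (isCompact_Icc.prod isCompact_Icc)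
  exact this.mono_set (Set.prod_mono Set.Ioc_subset_Icc_self Set.Ioc_subset_Icc_self)

/-- The variance of the time average of a product of jointly Gaussian processes. -/
lemma HasBoundedSpectrum.norm_integral_prod_sq_le (h : HasBoundedSpectrum x f C) {y : ℝ → E}
    (hy : Continuous y) {R : ℝ} (hR : ∀ t, ‖y t‖ ≤ R) {F : Type*} [NormedAddCommGroup F]
    [InnerProductSpace ℝ F] [CompleteSpace F] {p : ℝ → F} (hp : Continuous p)
    (hpi : ∀ t s, ⟪p t, p s⟫ = ⟪y t, y s⟫ * ⟪x t, x s⟫ + ⟪y t, x s⟫ * ⟪x t, y s⟫) {T : ℝ}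
    (hT : 0 ≤ T) : ‖∫ t in (0 : ℝ)..T, p t‖ ^ 2 ≤ 4 * Real.pi * C * R ^ 2 * T := by
  have hx := h.cont
  have hB : 0 ≤ 2 * Real.pi * C := mul_nonneg (by positivity) h.bound_nonneg
  set μ : Measure ℝ := volume.restrict (Set.Ioc 0 T) with hμ
  have i1 : Integrable (fun q : ℝ × ℝ => ⟪y q.1, y q.2⟫ * ⟪x q.1, x q.2⟫) (μ.prod μ) :=
    integrable_prod_restrict_Ioc (by fun_prop) 0 T
  have i2 : Integrable (fun q : ℝ × ℝ => ⟪y q.1, x q.2⟫ * ⟪x q.1, y q.2⟫) (μ.prod μ) :=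
    integrable_prod_restrict_Ioc (by fun_prop) 0 T
  have i3 : Integrable (fun q : ℝ × ℝ => ⟪y q.1, x q.2⟫ ^ 2) (μ.prod μ) :=
    integrable_prod_restrict_Ioc (by fun_prop) 0 T
  have i4 : Integrable (fun q : ℝ × ℝ => ⟪y q.2, x q.1⟫ ^ 2) (μ.prod μ) :=
    integrable_prod_restrict_Ioc (by fun_prop) 0 T
  obtain ⟨hy1, hy2⟩ := restrict_Ioc_facts hy 0 T
  have hyR : 2 * Real.pi * C * ∫ s, ‖y s‖ ^ 2 ∂μ ≤ 2 * Real.pi * C * (R ^ 2 * T) := by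
    refine mul_le_mul_of_nonneg_left ?_ hB
    calc ∫ s, ‖y s‖ ^ 2 ∂μ ≤ ∫ _, R ^ 2 ∂μ := by
          refine integral_mono hy2 (integrable_const _) fun s => ?_
          have := hR s
          simp only
          gcongr
      _ = R ^ 2 * T := by
          rw [integral_const, hμ, measureReal_restrict_apply_univ, Real.volume_real_Ioc_of_le hT,
            smul_eq_mul, sub_zero, mul_comm]
  -- First Isserlis term: here ⟨x, x'⟩ is the spectral kernel and the curve y is the Hilbert-valued
  -- argument.
  have b1 : ∫ q : ℝ × ℝ, ⟪y q.1, y q.2⟫ * ⟪x q.1, x q.2⟫ ∂μ.prod μ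
      ≤ 2 * Real.pi * C * ∫ s, ‖y s‖ ^ 2 ∂μ := by
    simp only [h.inner_eq]
    exact integral_inner_mul_spectral_le Measure.restrict_le_self hy1 hy2 h.integrable h.nonneg
      h.le
  -- The dual bound is applied with v = y(s) for each fixed s and then integrated. The crossed
  -- Isserlis term reduces to this one by 2uv ≤ u² + v² and the symmetry of the square.
  have b3 : ∫ q : ℝ × ℝ, ⟪y q.1, x q.2⟫ ^ 2 ∂μ.prod μ ≤ 2 * Real.pi * C * ∫ s, ‖y s‖ ^ 2 ∂μ := by
    rw [integral_prod _ i3, ← integral_const_mul]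
    refine integral_mono i3.integral_prod_left (hy2.const_mul _) fun s => ?_
    have := h.integral_inner_sq_le (y s) hT
    rwa [intervalIntegral.integral_of_le hT] at this
  have b4 : ∫ q : ℝ × ℝ, ⟪y q.2, x q.1⟫ ^ 2 ∂μ.prod μ
      = ∫ q : ℝ × ℝ, ⟪y q.1, x q.2⟫ ^ 2 ∂μ.prod μ :=
    integral_prod_swap (μ := μ) (ν := μ) (fun q : ℝ × ℝ => ⟪y q.1, x q.2⟫ ^ 2)
  have b2 : ∫ q : ℝ × ℝ, ⟪y q.1, x q.2⟫ * ⟪x q.1, y q.2⟫ ∂μ.prod μ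
      ≤ ∫ q : ℝ × ℝ, ⟪y q.1, x q.2⟫ ^ 2 ∂μ.prod μ := by
    calc ∫ q : ℝ × ℝ, ⟪y q.1, x q.2⟫ * ⟪x q.1, y q.2⟫ ∂μ.prod μ
        ≤ ∫ q : ℝ × ℝ, (1 / 2) * (⟪y q.1, x q.2⟫ ^ 2 + ⟪y q.2, x q.1⟫ ^ 2) ∂μ.prod μ := by
          refine integral_mono i2 ((i3.add i4).const_mul _) fun q => ?_
          simp only
          rw [real_inner_comm (y q.2) (x q.1)]
          nlinarith [sq_nonneg (⟪y q.1, x q.2⟫ - ⟪y q.2, x q.1⟫)]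
      _ = _ := by
          rw [integral_const_mul, integral_add i3 i4, b4]
          ring
  rw [intervalIntegral.integral_of_le hT, norm_sq_integral (restrict_Ioc_facts hp 0 T).1]
  simp only [hpi]
  rw [integral_add i1 i2]
  linarith

end Response

/-! ### The correlogram for a fixed input -/

section FixedInput

open RealInnerProductSpace

variable {P : Measure Ω}

lemma IsStationaryGaussian.memLp {Z : ℝ → Ω → ℝ} (hZ : IsStationaryGaussian P Z) (t : ℝ) :
    MemLp (Z t) 2 P := (hZ.gaussian.hasGaussianLaw_eval t).memLp_two

lemma IsStationaryGaussian.integral_mul {Z : ℝ → Ω → ℝ} (hZ : IsStationaryGaussian P Z)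
    (s t : ℝ) : ∫ ω, Z s ω * Z t ω ∂P = corr P Z (s - t) := by
  have := hZ.stationary t (s - t)
  rwa [add_sub_cancel] at this

lemma inner_eq_integral {V W : Ω → ℝ} {v w : Lp ℝ 2 P} (hv : V =ᵐ[P] v) (hw : W =ᵐ[P] w) :
    ⟪v, w⟫ = ∫ ω, V ω * W ω ∂P := by
  rw [← integral_coe_mul_coe]
  refine integral_congr_ae ?_
  filter_upwards [hv, hw] with ω h1 h2
  rw [h1, h2]

lemma coe_intervalIntegral {S : Submodule ℝ (Lp ℝ 2 P)} [CompleteSpace S] {φ : ℝ → S}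
    (hφ : Continuous φ) (a b : ℝ) :
    ((∫ t in a..b, φ t : S) : Lp ℝ 2 P) = ∫ t in a..b, (φ t : Lp ℝ 2 P) :=
  (S.subtypeL.intervalIntegral_comp_comm (hφ.intervalIntegrable a b)).symm

variable [IsProbabilityMeasure P]

/-- The data of the system realised in a Gaussian Hilbert space. -/
structure Realisation (P : Measure Ω) (X U : ℝ → Ω → ℝ) where
  space : Submodule ℝ (Lp ℝ 2 P)
  closed : IsClosed (space : Set (Lp ℝ 2 P))
  gaussian : IsGaussianSpace space
  x : ℝ → space
  u : ℝ → space
  ae_x : ∀ t, X t =ᵐ[P] (x t : Lp ℝ 2 P)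
  ae_u : ∀ t, U t =ᵐ[P] (u t : Lp ℝ 2 P)

/-- Input and noise must lie in one Gaussian space so that Isserlis' formula applies to response and
input together. Closedness makes the space complete, so the response stays in it. -/
lemma nonempty_realisation {X U : ℝ → Ω → ℝ} (hX : IsStationaryGaussian P X)
    (hU : IsStationaryGaussian P U) (hXU : IsGaussianProcess (Sum.elim X U) P) :
    Nonempty (Realisation P X U) := by
  set z : ℝ ⊕ ℝ → Lp ℝ 2 P :=
    Sum.elim (fun t => (hX.memLp t).toLp) (fun t => (hU.memLp t).toLp) with hz_def
  have hz : ∀ i, Sum.elim X U i =ᵐ[P] z i := by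
    rintro (t | t)
    · exact (MemLp.coeFn_toLp (hX.memLp t)).symm
    · exact (MemLp.coeFn_toLp (hU.memLp t)).symm
  have h0 : ∀ i, ∫ ω, Sum.elim X U i ω ∂P = 0 := by
    rintro (t | t)
    · exact hX.centred t
    · exact hU.centred t
  have hmem : ∀ i, z i ∈ (Submodule.span ℝ (Set.range z)).topologicalClosure := fun i =>
    Submodule.le_topologicalClosure _ (Submodule.subset_span ⟨i, rfl⟩)
  exact ⟨{
    space := (Submodule.span ℝ (Set.range z)).topologicalClosure
    closed := Submodule.isClosed_topologicalClosure _
    gaussian := isGaussianSpace_closure_span hXU h0 hz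
    x := fun t => ⟨z (Sum.inl t), hmem _⟩
    u := fun t => ⟨z (Sum.inr t), hmem _⟩
    ae_x := fun t => hz (Sum.inl t)
    ae_u := fun t => hz (Sum.inr t) }⟩

/-- Existence of the integrals and a mean-square error bound for a fixed input. -/
theorem correlogram_fixed_input {X U : ℝ → Ω → ℝ} {f g H : ℝ → ℝ} {c C : ℝ}
    (hX : IsStationaryGaussian P X) (hfX : IsSpectralDensity f (corr P X))
    (hfC : ∀ l, f l ≤ C) (hc : 0 < c) (hK : Integrable (corr P X))
    (hU : IsStationaryGaussian P U) (hgU : IsSpectralDensity g (corr P U))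
    (hXU : IsGaussianProcess (Sum.elim X U) P) (horth : ∀ s t, ∫ ω, X s ω * U t ω ∂P = 0)
    (hH : Continuous H) (hH2 : MemLp H 2 volume) :
    (∀ t : ℝ, ∃ I, IsMSIntegral P (fun s ω => H s * X (t - s) ω) I) ∧
    (∀ T, 0 < T → ∀ τ : ℝ,
      ∃ I, IsMSRiemannIntegral P (fun t ω => response P H X U (t + τ) ω * X t ω) 0 T I) ∧
    ∀ T, 0 < T → ∀ τ : ℝ, ∫ ω, |estimator P c H X U T τ ω - H τ| ^ 2 ∂P
      ≤ 8 * Real.pi * C * (√(2 * Real.pi * C * ∫ s, H s ^ 2) + √(corr P U 0)) ^ 2 / (c ^ 2 * T)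
        + 2 * (1 / c * (∫ s, H s * corr P X (τ - s)) - H τ) ^ 2 := by
  obtain ⟨r⟩ := nonempty_realisation hX hU hXU
  have : CompleteSpace r.space := r.closed.completeSpace_coe
  have hxx : ∀ s t, ⟪r.x s, r.x t⟫ = corr P X (s - t) := fun s t => by
    rw [Submodule.coe_inner, inner_eq_integral (r.ae_x s) (r.ae_x t), hX.integral_mul]
  have huu : ∀ s t, ⟪r.u s, r.u t⟫ = corr P U (s - t) := fun s t => by
    rw [Submodule.coe_inner, inner_eq_integral (r.ae_u s) (r.ae_u t), hU.integral_mul]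
  have hxu : ∀ s t, ⟪r.x s, r.u t⟫ = 0 := fun s t => by
    rw [Submodule.coe_inner, inner_eq_integral (r.ae_x s) (r.ae_u t), horth]
  have hxc : Continuous r.x := continuous_of_inner_eq hfX.continuous hxx
  have huc : Continuous r.u := continuous_of_inner_eq hgU.continuous huu
  have hspec : HasBoundedSpectrum r.x f C :=
    ⟨hxc, hfX.integrable, hfX.nonneg, hfC, fun s t => by rw [hxx, hfX.eq_cos]⟩
  obtain ⟨z, hzc, hz⟩ := hspec.exists_response hH hH2
  have hφc : ∀ t, Continuous fun s => ((H s • r.x (t - s) : r.space) : Lp ℝ 2 P) := fun t => by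
    fun_prop
  have hφae : ∀ t s, (fun ω => H s * X (t - s) ω)
      =ᵐ[P] ((H s • r.x (t - s) : r.space) : Lp ℝ 2 P) := fun t s => by
    rw [Submodule.coe_smul]
    filter_upwards [r.ae_x (t - s), Lp.coeFn_smul (H s) (r.x (t - s) : Lp ℝ 2 P)] with ω h1 h2
    rw [h2, Pi.smul_apply, smul_eq_mul, h1]
  -- The limit was taken in the subspace; the continuous inclusion carries it to L₂(P), where
  -- mean-square integrals live.
  have hzL : ∀ t, Tendsto (fun p : ℝ × ℝ =>
      ∫ s in p.1..p.2, ((H s • r.x (t - s) : r.space) : Lp ℝ 2 P)) (atBot ×ˢ atTop)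
      (𝓝 (z t : Lp ℝ 2 P)) := fun t => by
    refine ((continuous_subtype_val.tendsto _).comp (hz t)).congr fun p => ?_
    exact coe_intervalIntegral (by fun_prop) _ _
  have hresp : ∀ t, response P H X U t =ᵐ[P] ((z t + r.u t : r.space) : Lp ℝ 2 P) := fun t => by
    rw [Submodule.coe_add]
    filter_upwards [msIntegral_ae_eq (hφc t) (hφae t) (hzL t), r.ae_u t,
      Lp.coeFn_add (z t : Lp ℝ 2 P) (r.u t)] with ω h1 h2 h3
    rw [h3, Pi.add_apply, response, h1, h2]
  have hpc : ∀ τ, Continuous fun t => r.gaussian.prod (z (t + τ) + r.u (t + τ)) (r.x t) :=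
    fun τ => r.gaussian.continuous_prod (by fun_prop) hxc
  have hpae : ∀ τ t, (fun ω => response P H X U (t + τ) ω * X t ω)
      =ᵐ[P] r.gaussian.prod (z (t + τ) + r.u (t + τ)) (r.x t) := fun τ t => by
    filter_upwards [hresp (t + τ), r.ae_x t,
      r.gaussian.coeFn_prod (z (t + τ) + r.u (t + τ)) (r.x t)] with ω h1 h2 h3
    rw [h3, h1, h2]
  refine ⟨fun t => ⟨_, isMSIntegral_of_tendsto (hφc t) (hφae t) (hzL t)⟩,
    fun T hT τ => ⟨_, isMSRiemannIntegral_integral (hpc τ) (hpae τ) hT.le⟩, fun T hT τ => ?_⟩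
  set y : ℝ → r.space := fun t => z (t + τ) + r.u (t + τ) with hy_def
  have hyc : Continuous y := by fun_prop
  set R : ℝ := √(2 * Real.pi * C * ∫ s, H s ^ 2) + √(corr P U 0) with hR_def
  have hyR : ∀ t, ‖y t‖ ≤ R := fun t => by
    refine (norm_add_le _ _).trans (add_le_add ?_ ?_)
    · exact Real.le_sqrt_of_sq_le (hspec.norm_response_sq_le hH hH2 (hz _))
    · refine Real.le_sqrt_of_sq_le ?_
      rw [← real_inner_self_eq_norm_sq, huu, sub_self]
  set ρ : ℝ := ∫ s, H s * corr P X (τ - s) with hρ_def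
  -- The mean of the product does not depend on t, and orthogonality removes the noise.
  have hρ : ∀ t, ⟪y t, r.x t⟫ = ρ := fun t => by
    have hKτ : MemLp (fun s => corr P X (τ - s)) 2 volume :=
      (hfX.memLp_two hK).comp_measurePreserving (Measure.measurePreserving_sub_left volume τ)
    rw [hy_def, real_inner_comm, inner_add_right, hxu, add_zero,
      hspec.inner_response hH (hz (t + τ)) (k := fun s => corr P X (τ - s)) (fun s => ?_)
        (hH2.integrable_mul hKτ)]
    rw [hxx, ← hfX.even]
    congr 1
    ring
  set p : ℝ → Lp ℝ 2 P := fun t => r.gaussian.prod (y t) (r.x t) with hp_def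
  have hpc' : Continuous p := hpc τ
  -- Centring cancels exactly the Isserlis term ⟨y t, x t⟩⟨y s, x s⟩ = ρ², leaving the two terms
  -- that decay after averaging.
  have hq : ∀ t s, ⟪p t - ρ • oneLp P, p s - ρ • oneLp P⟫
      = ⟪y t, y s⟫ * ⟪r.x t, r.x s⟫ + ⟪y t, r.x s⟫ * ⟪r.x t, y s⟫ := fun t s => by
    rw [inner_sub_left, inner_sub_right, inner_sub_right, real_inner_smul_left,
      real_inner_smul_right, real_inner_smul_right, real_inner_smul_left,
      real_inner_comm (p s) (oneLp P), inner_oneLp_oneLp, hp_def]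
    simp only [r.gaussian.inner_prod_oneLp, r.gaussian.inner_prod, hρ]
    ring
  have hvar := hspec.norm_integral_prod_sq_le hyc hyR
    (p := fun t => p t - ρ • oneLp P) (by fun_prop) hq hT.le
  have hsub : ∫ t in (0 : ℝ)..T, (p t - ρ • oneLp P)
      = (∫ t in (0 : ℝ)..T, p t) - (T * ρ) • oneLp P := by
    rw [intervalIntegral.integral_sub (hpc'.intervalIntegrable _ _) (by simp),
      intervalIntegral.integral_const, sub_zero, smul_smul]
  set I : Lp ℝ 2 P := ∫ t in (0 : ℝ)..T, p t with hI_def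
  have herr : (fun ω => estimator P c H X U T τ ω - H τ)
      =ᵐ[P] ((1 / (c * T)) • I - H τ • oneLp P : Lp ℝ 2 P) := by
    filter_upwards [msRiemannIntegral_ae_eq (hpc τ) (hpae τ) hT.le, coeFn_oneLp (P := P),
      Lp.coeFn_sub ((1 / (c * T)) • I) (H τ • oneLp P), Lp.coeFn_smul (1 / (c * T)) I,
      Lp.coeFn_smul (H τ) (oneLp P)] with ω h1 h2 h3 h4 h5
    rw [h3, Pi.sub_apply, h4, h5, Pi.smul_apply, Pi.smul_apply, h2, estimator, h1]
    simp only [smul_eq_mul, mul_one]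
    rfl
  have hmse : ∫ ω, |estimator P c H X U T τ ω - H τ| ^ 2 ∂P
      = ‖(1 / (c * T)) • I - H τ • oneLp P‖ ^ 2 := by
    rw [← integral_sq_coe]
    refine integral_congr_ae ?_
    filter_upwards [herr] with ω hω
    rw [sq_abs, hω]
  -- Fluctuation plus bias. The cross term is not computed: (a + b)² ≤ 2a² + 2b² is enough.
  have hdecomp : (1 / (c * T)) • I - H τ • oneLp P
      = (1 / (c * T)) • (I - (T * ρ) • oneLp P) + (1 / c * ρ - H τ) • oneLp P := by
    rw [smul_sub, smul_smul, sub_smul, show 1 / (c * T) * (T * ρ) = 1 / c * ρ by field_simp]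
    abel
  have hone : ‖oneLp P‖ ^ 2 = 1 := by rw [← real_inner_self_eq_norm_sq, inner_oneLp_oneLp]
  rw [hsub] at hvar
  rw [hmse, hdecomp]
  have hA : ‖(1 / (c * T)) • (I - (T * ρ) • oneLp P)‖ ^ 2
      ≤ 4 * Real.pi * C * R ^ 2 / (c ^ 2 * T) := by
    rw [norm_smul, mul_pow, Real.norm_of_nonneg (by positivity)]
    refine (mul_le_mul_of_nonneg_left hvar (by positivity)).trans_eq ?_
    field_simp
  have hB : ‖(1 / c * ρ - H τ) • oneLp P‖ ^ 2 = (1 / c * ρ - H τ) ^ 2 := by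
    rw [norm_smul, mul_pow, hone, mul_one, Real.norm_eq_abs, sq_abs]
  set a := ‖(1 / (c * T)) • (I - (T * ρ) • oneLp P)‖
  set b := ‖(1 / c * ρ - H τ) • oneLp P‖
  calc ‖(1 / (c * T)) • (I - (T * ρ) • oneLp P) + (1 / c * ρ - H τ) • oneLp P‖ ^ 2
      ≤ (a + b) ^ 2 := by gcongr; exact norm_add_le _ _
    _ ≤ 2 * a ^ 2 + 2 * b ^ 2 := by nlinarith [sq_nonneg (a - b)]
    _ ≤ 2 * (4 * Real.pi * C * R ^ 2 / (c ^ 2 * T)) + 2 * (1 / c * ρ - H τ) ^ 2 := by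
        rw [hB]; linarith
    _ = _ := by ring

end FixedInput

end Correlogram

end

theorem mainTheorem12 {Ω : Type*} [MeasurableSpace Ω] (P : Measure Ω) [IsProbabilityMeasure P]
    (X : ℝ → ℝ → Ω → ℝ) (U : ℝ → Ω → ℝ) (f : ℝ → ℝ → ℝ) (g H : ℝ → ℝ) (c α : ℝ)
    -- the input processes and their spectral densities
    (hX : ∀ Δ, 0 < Δ → Correlogram.IsStationaryGaussian P (X Δ))
    (hfX : ∀ Δ, 0 < Δ → Correlogram.IsSpectralDensity (f Δ) (Correlogram.corr P (X Δ)))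
    (hf_even : ∀ Δ, 0 < Δ → ∀ l, f Δ l = f Δ (-l))
    (hf_bdd : ∃ C : ℝ, ∀ Δ, 0 < Δ → ∀ l, |f Δ l| ≤ C)
    (hf_int : ∀ Δ, 0 < Δ → Integrable (f Δ))
    (hc : 0 < c)
    (hf_lim : ∀ a : ℝ, 0 < a →
      TendstoUniformlyOn f (fun _ => c / (2 * Real.pi)) atTop (Set.Icc (-a) a))
    (hK_int : ∀ Δ, 0 < Δ → Integrable (Correlogram.corr P (X Δ)))
    -- the inner noise, orthogonal to (and jointly Gaussian with) each input
    (hU : Correlogram.IsStationaryGaussian P U)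
    (hgU : Correlogram.IsSpectralDensity g (Correlogram.corr P U))
    (hg_even : ∀ l, g l = g (-l))
    (hg_int : Integrable g)
    (hXU_gauss : ∀ Δ, 0 < Δ → IsGaussianProcess (Sum.elim (X Δ) U) P)
    (hXU_orth : ∀ Δ, 0 < Δ → ∀ s t, ∫ ω, X Δ s ω * U t ω ∂P = 0)
    -- the transfer function
    (hα : 0 < α) (hα' : α ≤ 1)
    (hH_lip : Correlogram.LipClass α H)
    (hH_L2 : MemLp H 2 volume)
    -- the balance conditions
    (hK_a : ∀ δ : ℝ, 0 < δ →
      Tendsto (fun Δ => ∫ t in Set.Ioi δ, Correlogram.corr P (X Δ) t) atTop (𝓝 0))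
    (hK_b : ∀ δ : ℝ, 0 < δ →
      Tendsto (fun Δ => ∫ t in Set.Ioi δ, (Correlogram.corr P (X Δ) t) ^ 2) atTop (𝓝 0))
    (hK_c : ∃ δ : ℝ, 0 < δ ∧
      Tendsto (fun Δ => ∫ t in (-δ)..δ, |Correlogram.corr P (X Δ) t| * |t| ^ α) atTop (𝓝 0)) :
    -- the integrals that define the response and the estimator exist
    (∀ Δ, 0 < Δ → ∀ t : ℝ,
      ∃ I, Correlogram.IsMSIntegral P (fun s ω => H s * X Δ (t - s) ω) I) ∧
    (∀ T Δ, 0 < T → 0 < Δ → ∀ τ : ℝ,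
      ∃ I, Correlogram.IsMSRiemannIntegral P
        (fun t ω => Correlogram.response P H (X Δ) U (t + τ) ω * X Δ t ω) 0 T I) ∧
    -- mean-square consistency
    ∀ τ : ℝ,
      Tendsto (fun p : ℝ × ℝ =>
          ∫ ω, |Correlogram.estimator P c H (X p.2) U p.1 τ ω - H τ| ^ 2 ∂P)
        (atTop ×ˢ atTop) (𝓝 0) := by
  obtain ⟨C, hC⟩ := hf_bdd
  have hHc := hH_lip.continuous hα
  have hfixed := fun Δ (hΔ : 0 < Δ) => Correlogram.correlogram_fixed_input (hX Δ hΔ) (hfX Δ hΔ)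
    (fun l => (le_abs_self _).trans (hC Δ hΔ l)) hc (hK_int Δ hΔ) hU hgU (hXU_gauss Δ hΔ)
    (hXU_orth Δ hΔ) hHc hH_L2
  refine ⟨fun Δ hΔ => (hfixed Δ hΔ).1, fun T Δ hT hΔ => (hfixed Δ hΔ).2.1 T hT, fun τ => ?_⟩
  have hmass := Correlogram.tendsto_integral_corr hc hfX hK_int hC (hf_lim 1 one_pos)
  have hbias := Correlogram.tendsto_integral_mul_corr hα hfX hK_int hmass hH_lip hH_L2 hK_a hK_b
    hK_c τ
  -- `D` is free of both T and Δ, so the error bound is a function of T plus a function of Δ and the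
  -- product limit splits.
  set D : ℝ := 8 * Real.pi * C *
    (√(2 * Real.pi * C * ∫ s, H s ^ 2) + √(Correlogram.corr P U 0)) ^ 2
  have h1 : Tendsto (fun T : ℝ => D / (c ^ 2 * T)) atTop (𝓝 0) :=
    tendsto_const_nhds.div_atTop (tendsto_id.const_mul_atTop (by positivity))
  have h2 : Tendsto (fun Δ => 2 * (1 / c * (∫ s, H s * Correlogram.corr P (X Δ) (τ - s))
      - H τ) ^ 2) atTop (𝓝 0) := by
    have := (((hbias.const_mul (1 / c)).sub_const (H τ)).pow 2).const_mul 2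
    rwa [show 2 * (1 / c * (c * H τ) - H τ) ^ 2 = 0 by field_simp; ring] at this
  have h3 := (h1.comp tendsto_fst).add (h2.comp (tendsto_snd (f := (atTop : Filter ℝ))))
  rw [add_zero] at h3
  refine squeeze_zero' (Eventually.of_forall fun _ => integral_nonneg fun _ => by positivity) ?_ h3
  filter_upwards [(eventually_gt_atTop (0 : ℝ)).prod_mk (eventually_gt_atTop (0 : ℝ))] with p hp
  exact (hfixed p.2 hp.2).2.2 p.1 hp.1 τ
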